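/- Let $N_5$ be the closed connected non-orientable surface of genus $5$, i.e. the connected sum of five projective planes (the quotient of a closed disc whose boundary is glued according to the word $a_1a_1a_2a_2\cdots a_5a_5$). A triangulation of $N_5$ is a two-dimensional simplicial complex $\Delta$ whose underlying space $|\Delta|$ is homeomorphic to $N_5$. A polyhedral realization of $\Delta$ in $\mathbb R^3$ is a simplexwise linear immersion, i.e. a locally injective map $\phi_\psi\colon|\Delta|\to\mathbb R^3$ that is induced, linearly on each simplex, by an assignment $\psi\colon V\to\mathbb R^3$ of coordinates to the vertices of $\Delta$. A geometric symmetry of it is an isometry $R$ of $\mathbb R^3$ that maps $\phi_\psi(|\Delta|)$ onto itself and is induced by an automorphism $\sigma$ of $\Delta$, i.e. $R(\psi(v))=\psi(\sigma(v))$ for every vertex $v$. At least $10$ triangulations of $N_5$ with $10$ vertices, pairwise non-isomorphic as simplicial complexes, admit polyhedral realizations in $\mathbb R^3$. Moreover, each of these $10$ triangulations has a polyhedral realization with integer vertex coordinates ($\psi\colon V\to\mathbb Z^3$) that possesses a $3$-fold rotational symmetry, i.e. a geometric symmetry that is a rotation of order $3$. -/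

import Mathlib

namespace PolyhedralSurface

/-- Euclidean 3-space. -/
abbrev E3 : Type := EuclideanSpace ℝ (Fin 3)

/-! ### The closed non-orientable surface of genus `h` -/

/-- The side identifications of the `2h`-gon with boundary word `a₁a₁a₂a₂⋯a_ha_h`, the polygon being
the closed unit disc whose boundary circle is divided into `2h` equal arcs: the arc number `2k`,
`k < h`, is glued to the arc number `2k + 1`, both traversed counterclockwise. -/
def crosscapRel (h : ℕ) (x y : Metric.closedBall (0 : ℂ) 1) : Prop :=
  ∃ k : Fin h, ∃ t ∈ Set.Icc (0 : ℝ) 1,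
    (x : ℂ) = Complex.exp (2 * Real.pi * Complex.I * ((2 * (k : ℕ) + t) / (2 * h))) ∧
    (y : ℂ) = Complex.exp (2 * Real.pi * Complex.I * ((2 * (k : ℕ) + 1 + t) / (2 * h)))

/-- The closed non-orientable surface `N_h` of genus `h ≥ 1`, i.e. the connected sum of `h`
projective planes, in its polygonal normal form: the closed disc modulo the equivalence relation
generated by the identifications `a₁a₁a₂a₂⋯a_ha_h` (for `h = 1` this is the disc with antipodal
boundary points identified, the projective plane). -/
def NonorientableSurface (h : ℕ) : Type := Quot (crosscapRel h)

instance (h : ℕ) : TopologicalSpace (NonorientableSurface h) :=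
  inferInstanceAs (TopologicalSpace (Quot (crosscapRel h)))

/-! ### Triangulations -/

section Complex

variable {V W : Type*} [Fintype V]

/-- The underlying space `|Δ|` of a finite simplicial complex, in barycentric coordinates:
points of the standard simplex on the vertex set whose support is a face. It carries the
subspace topology. -/
def space (Δ : AbstractSimplicialComplex V) : Set (V → ℝ) :=
  {x | (∀ v, 0 ≤ x v) ∧ ∑ v, x v = 1 ∧ ∃ s ∈ Δ.faces, ∀ v, v ∈ s ↔ x v ≠ 0}

/-- `Δ` is a triangulation of the topological space `S`: a two-dimensional simplicial complex
whose underlying space is homeomorphic to `S`. All elements of `V` are vertices of `Δ`, so that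
the number of vertices is the cardinality of `V`. -/
def IsTriangulationOf (Δ : AbstractSimplicialComplex V) (S : Type*) [TopologicalSpace S] : Prop :=
  (∀ s ∈ Δ.faces, s.card ≤ 3) ∧ (∃ s ∈ Δ.faces, s.card = 3) ∧ Nonempty (space Δ ≃ₜ S)

/-- A bijection of the vertex sets is an isomorphism of simplicial complexes if it maps exactly
the faces to faces. -/
def IsIso (Δ : AbstractSimplicialComplex V) (Γ : AbstractSimplicialComplex W) (σ : V ≃ W) : Prop :=
  ∀ s : Finset V, s ∈ Δ.faces ↔ s.map σ.toEmbedding ∈ Γ.faces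

/-! ### Realizations and their symmetries -/

/-- The simplexwise linear map `|Δ| → ℝ³` induced by an assignment of coordinates to the
vertices. -/
noncomputable def simplexwiseLinear (Δ : AbstractSimplicialComplex V) (ψ : V → E3) :
    space Δ → E3 :=
  fun x => ∑ v, (x : V → ℝ) v • ψ v

/-- The assignment `ψ` of coordinates to the vertices defines a polyhedral realization of (a
triangulation of a non-orientable surface) `Δ`: the induced simplexwise linear map is a simplexwise
linear immersion, i.e. it is locally injective. -/
def IsImmersion (Δ : AbstractSimplicialComplex V) (ψ : V → E3) : Prop :=
  IsLocallyInjective (simplexwiseLinear Δ ψ)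

/-- The isometry `R` is a geometric symmetry of the realization of `Δ` given by `ψ`: it maps the
image of `|Δ|` onto itself and is induced by an automorphism of `Δ`. -/
def IsGeometricSymmetry (Δ : AbstractSimplicialComplex V) (ψ : V → E3) (R : E3 ≃ᵃⁱ[ℝ] E3) : Prop :=
  R '' Set.range (simplexwiseLinear Δ ψ) = Set.range (simplexwiseLinear Δ ψ) ∧
    ∃ σ : V ≃ V, IsIso Δ Δ σ ∧ ∀ v, R (ψ v) = ψ (σ v)

end Complex

/-- A 3-fold rotation of Euclidean 3-space: an orientation-preserving isometry of order 3
(an isometry of finite order has a fixed point, so this is a rotation by `±2π/3` about a line). -/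
def IsThreefoldRotation (R : E3 ≃ᵃⁱ[ℝ] E3) : Prop :=
  LinearMap.det (R.linearIsometryEquiv.toLinearEquiv : E3 →ₗ[ℝ] E3) = 1 ∧ orderOf R = 3

end PolyhedralSurface

namespace PolyhedralSurface

open Finset

/-! ### Carriers and bistellar moves -/

section Carrier

variable {V W : Type*}

lemma inf'_eq_zero {A : Finset V} (hA : A.Nonempty) {x : V → ℝ} (hx : ∀ v, 0 ≤ x v) {u : V}
    (hu : u ∈ A) (h : x u = 0) : A.inf' hA x = 0 :=
  le_antisymm (h ▸ inf'_le x hu) (le_inf' hA x fun v _ => hx v)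

variable [DecidableEq V] [DecidableEq W]

/-- Remove the common part of the coordinates in `A` and distribute it evenly over `B`. -/
noncomputable def exchange (A B : Finset V) (hA : A.Nonempty) (x : V → ℝ) : V → ℝ := fun v =>
  x v - (if v ∈ A then A.inf' hA x else 0) +
    (if v ∈ B then (#A : ℝ) / #B * A.inf' hA x else 0)

lemma continuous_exchange (A B : Finset V) (hA : A.Nonempty) : Continuous (exchange A B hA) := by
  have h : Continuous fun x : V → ℝ => A.inf' hA x :=
    Continuous.finset_inf'_apply hA fun i _ => continuous_apply i
  refine continuous_pi fun v => ?_
  unfold exchange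
  split_ifs <;> fun_prop

lemma exchange_eq_self {A : Finset V} (B : Finset V) (hA : A.Nonempty) {x : V → ℝ}
    (h : A.inf' hA x = 0) : exchange A B hA x = x := by
  funext v
  simp [exchange, h]

lemma exchange_exchange {A B : Finset V} (hA : A.Nonempty) (hB : B.Nonempty) (hAB : Disjoint A B)
    {x : V → ℝ} (h : B.inf' hB x = 0) : exchange B A hB (exchange A B hA x) = x := by
  have hm : B.inf' hB (exchange A B hA x) = (#A : ℝ) / #B * A.inf' hA x := by
    have hv : ∀ v ∈ B, exchange A B hA x v = x v + (#A : ℝ) / #B * A.inf' hA x := fun v hv => by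
      simp [exchange, hv, disjoint_right.1 hAB hv]
    apply le_antisymm
    · obtain ⟨u, hu, hux⟩ := exists_mem_eq_inf' hB x
      refine (inf'_le _ hu).trans ?_
      rw [hv u hu, ← hux, h, zero_add]
    · refine le_inf' hB _ fun v hvB => ?_
      rw [hv v hvB]
      have := inf'_le x hvB
      linarith
  have ha : (#A : ℝ) ≠ 0 := by exact_mod_cast hA.card_ne_zero
  have hb : (#B : ℝ) ≠ 0 := by exact_mod_cast hB.card_ne_zero
  funext v
  rw [exchange, hm]
  by_cases h1 : v ∈ A
  · have h2 := disjoint_left.1 hAB h1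
    simp only [exchange, h1, h2, if_true, if_false]
    field_simp
    ring
  · by_cases h2 : v ∈ B <;> simp [exchange, h1, h2]

/-- One direction of the combinatorial condition for a bistellar move. -/
structure MovesTo (A B : Finset V) (F G : Set (Finset V)) : Prop where
  avoids : ∀ t ∈ F, ¬ B ⊆ t
  keep : ∀ t ∈ F, ¬ A ⊆ t → ∃ t' ∈ G, t ⊆ t'
  replace : ∀ t ∈ F, A ⊆ t → ∀ u ∈ A, ∃ t' ∈ G, t.erase u ∪ B ⊆ t'

variable [Fintype V] [Fintype W]

/-- The underlying space, in barycentric coordinates, of the complex generated by a family of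
facets. -/
def carrier (F : Set (Finset V)) : Set (V → ℝ) :=
  {x | (∀ v, 0 ≤ x v) ∧ ∑ v, x v = 1 ∧ ∃ t ∈ F, ∀ v, x v ≠ 0 → v ∈ t}

lemma MovesTo.exchange_mem {A B : Finset V} {F G : Set (Finset V)} (h : MovesTo A B F G)
    (hA : A.Nonempty) (hB : B.Nonempty) {x : V → ℝ} (hx : x ∈ carrier F) :
    exchange A B hA x ∈ carrier G := by
  obtain ⟨h0, h1, t, ht, hs⟩ := hx
  have hm0 : 0 ≤ A.inf' hA x := le_inf' hA x fun v _ => h0 v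
  have hb : (#B : ℝ) ≠ 0 := by exact_mod_cast hB.card_ne_zero
  refine ⟨fun v => ?_, ?_, ?_⟩
  · have h2 : 0 ≤ (if v ∈ B then (#A : ℝ) / #B * A.inf' hA x else 0) := by
      split_ifs <;> positivity
    have h3 : 0 ≤ x v - (if v ∈ A then A.inf' hA x else 0) := by
      split_ifs with h
      · exact sub_nonneg.2 (inf'_le x h)
      · simpa using h0 v
    exact add_nonneg h3 h2
  · simp only [exchange, sum_add_distrib, sum_sub_distrib, h1, sum_ite_mem, univ_inter, sum_const,
      nsmul_eq_mul]
    field_simp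
    ring
  · by_cases hAt : A ⊆ t
    · obtain ⟨u, hu, hux⟩ := exists_mem_eq_inf' hA x
      obtain ⟨t', ht', hsub⟩ := h.replace t ht hAt u hu
      refine ⟨t', ht', fun v hv => hsub ?_⟩
      by_contra hcon
      simp only [mem_union, mem_erase, not_or, not_and] at hcon
      apply hv
      rw [exchange, if_neg hcon.2, add_zero]
      by_cases hvu : v = u
      · rw [hvu, if_pos hu, hux, sub_self]
      · have hvt := hcon.1 hvu
        rw [if_neg fun hvA => hvt (hAt hvA), sub_zero]
        by_contra hne
        exact hvt (hs v hne)
    · obtain ⟨t', ht', hsub⟩ := h.keep t ht hAt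
      obtain ⟨u, hu, hut⟩ := not_subset.1 hAt
      have hxu : x u = 0 := by
        by_contra hne
        exact hut (hs u hne)
      rw [exchange_eq_self B hA (inf'_eq_zero hA h0 hu hxu)]
      exact ⟨t', ht', fun v hv => hsub (hs v hv)⟩

lemma MovesTo.inf'_eq_zero {A B : Finset V} {F G : Set (Finset V)} (h : MovesTo A B F G)
    (hB : B.Nonempty) {x : V → ℝ} (hx : x ∈ carrier F) : B.inf' hB x = 0 := by
  obtain ⟨h0, -, t, ht, hs⟩ := hx
  obtain ⟨u, hu, hut⟩ := not_subset.1 (h.avoids t ht)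
  refine PolyhedralSurface.inf'_eq_zero hB h0 hu ?_
  by_contra hne
  exact hut (hs u hne)

/-- A bistellar move does not change the underlying space. -/
noncomputable def bistellarHomeomorph {A B : Finset V} {F G : Set (Finset V)} (hA : A.Nonempty)
    (hB : B.Nonempty) (hAB : Disjoint A B) (hFG : MovesTo A B F G) (hGF : MovesTo B A G F) :
    carrier F ≃ₜ carrier G where
  toFun x := ⟨exchange A B hA x, hFG.exchange_mem hA hB x.2⟩
  invFun y := ⟨exchange B A hB y, hGF.exchange_mem hB hA y.2⟩
  left_inv x := Subtype.ext (exchange_exchange hA hB hAB (hFG.inf'_eq_zero hB x.2))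
  right_inv y := Subtype.ext (exchange_exchange hB hA hAB.symm (hGF.inf'_eq_zero hA y.2))
  continuous_toFun := ((continuous_exchange A B hA).comp continuous_subtype_val).subtype_mk _
  continuous_invFun := ((continuous_exchange B A hB).comp continuous_subtype_val).subtype_mk _

/-- Vertices outside the complex are irrelevant for the underlying space. -/
noncomputable def carrierMapHomeomorph (ι : V ↪ W) (F : Set (Finset V)) (G : Set (Finset W))
    (hFG : ∀ t ∈ F, ∃ t' ∈ G, t.map ι ⊆ t') (hGF : ∀ t' ∈ G, ∃ t ∈ F, t' ⊆ t.map ι) :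
    carrier F ≃ₜ carrier G where
  toFun x := ⟨fun w => ∑ v, if ι v = w then x.1 v else 0, by
    obtain ⟨x, h0, h1, t, ht, hs⟩ := x
    obtain ⟨t', ht', hsub⟩ := hFG t ht
    refine ⟨fun w => sum_nonneg fun v _ => ?_, ?_, t', ht', fun w hw => ?_⟩
    · split_ifs
      exacts [h0 v, le_rfl]
    · rw [sum_comm]
      simpa using h1
    · obtain ⟨v, -, hv⟩ := exists_ne_zero_of_sum_ne_zero hw
      have hvw : ι v = w := by
        by_contra hne
        simp [hne] at hv
      rw [if_pos hvw] at hv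
      exact hsub (hvw ▸ mem_map_of_mem ι (hs v hv))⟩
  invFun y := ⟨fun v => y.1 (ι v), by
    obtain ⟨y, h0, h1, t', ht', hs⟩ := y
    obtain ⟨t, ht, hsub⟩ := hGF t' ht'
    refine ⟨fun v => h0 _, ?_, t, ht, fun v hv => ?_⟩
    · change ∑ v, y (ι v) = 1
      rw [← h1, ← sum_map univ ι]
      refine sum_subset (subset_univ _) fun w _ hw => ?_
      by_contra hne
      obtain ⟨v, -, rfl⟩ := mem_map.1 (hsub (hs w hne))
      exact hw (mem_map_of_mem ι (mem_univ v))
    · simpa using hsub (hs _ hv)⟩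
  left_inv x := by
    ext v
    simp
  right_inv y := by
    obtain ⟨y, h0, h1, t', ht', hs⟩ := y
    obtain ⟨t, ht, hsub⟩ := hGF t' ht'
    ext w
    by_cases hw : ∃ v, ι v = w
    · obtain ⟨v, rfl⟩ := hw
      simp
    · have hyw : y w = 0 := by
        by_contra hne
        obtain ⟨v, -, hv⟩ := mem_map.1 (hsub (hs w hne))
        exact hw ⟨v, hv⟩
      push Not at hw
      simp [hw, hyw]
  continuous_toFun := by
    refine Continuous.subtype_mk (continuous_pi fun w => continuous_finsetSum _ fun v _ => ?_) _
    split_ifs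
    · exact (continuous_apply v).comp continuous_subtype_val
    · exact continuous_const
  continuous_invFun := by
    refine Continuous.subtype_mk (continuous_pi fun v => ?_) _
    exact (continuous_apply (ι v)).comp continuous_subtype_val

end Carrier

/-! ### Facets encoded by bit masks -/

section Masks

variable {n : ℕ}

/-- The set of vertices encoded by a bit mask. -/
def bits (n m : ℕ) : Finset (Fin n) := univ.filter fun v => m.testBit v

@[simp] lemma mem_bits {m : ℕ} {v : Fin n} : v ∈ bits n m ↔ m.testBit v = true := by
  simp [bits]

/-- The facets encoded by a list of bit masks. -/
def facets (n : ℕ) (L : List ℕ) : Set (Finset (Fin n)) := {t | ∃ m ∈ L, bits n m = t}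

lemma bits_mono {a b : ℕ} (h : a &&& b = a) : bits n a ⊆ bits n b := fun v hv => by
  rw [mem_bits, ← h, Nat.testBit_and, Bool.and_eq_true] at hv
  exact mem_bits.2 hv.2

lemma land_eq_of_bits_subset {a b : ℕ} (ha : a < 2 ^ n) (h : bits n a ⊆ bits n b) :
    a &&& b = a := by
  refine Nat.eq_of_testBit_eq fun i => ?_
  rw [Nat.testBit_and]
  by_cases hi : a.testBit i = true
  · have hin : i < n := by
      by_contra hcon
      rw [Nat.testBit_lt_two_pow (ha.trans_le (Nat.pow_le_pow_right two_pos (not_lt.1 hcon)))] at hi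
      exact absurd hi (by simp)
    have := mem_bits.1 (h (mem_bits.2 (show a.testBit (⟨i, hin⟩ : Fin n) = true from hi)))
    simp_all
  · simp_all

lemma bits_nonempty {a : ℕ} (ha : a < 2 ^ n) (h : a ≠ 0) : (bits n a).Nonempty := by
  rw [nonempty_iff_ne_empty]
  intro he
  have := land_eq_of_bits_subset (b := 0) ha (by simp [he])
  exact h (by simpa using this.symm)

/-- The vertices encoded by a bit mask, as a list. -/
def bitList (n m : ℕ) : List ℕ := (List.range n).filter fun i => m.testBit i

lemma mem_bitList {m : ℕ} {v : Fin n} (hv : v ∈ bits n m) : (v : ℕ) ∈ bitList n m := by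
  simp [bitList, mem_bits.1 hv]

lemma exists_fin_of_mem_bitList {m i : ℕ} (h : i ∈ bitList n m) : ∃ v ∈ bits n m, (v : ℕ) = i := by
  simp only [bitList, List.mem_filter, List.mem_range] at h
  exact ⟨⟨i, h.1⟩, mem_bits.2 h.2, rfl⟩

lemma mem_bits_xor {m : ℕ} {u v : Fin n} (hu : u ∈ bits n m) :
    v ∈ bits n (m ^^^ 2 ^ (u : ℕ)) ↔ v ∈ bits n m ∧ v ≠ u := by
  rw [mem_bits] at hu
  rw [mem_bits, mem_bits, Nat.testBit_xor, Nat.testBit_two_pow]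
  by_cases h : v = u
  · simp [h, hu]
  · have : (u : ℕ) ≠ v := fun h' => h (Fin.ext h'.symm)
    simp [h, this]

/-- The result of the bistellar move that replaces `A` by `B`. -/
def move (n A B : ℕ) (L : List ℕ) : List ℕ :=
  L.flatMap fun t => if A &&& t = A then (bitList n A).map fun u => (t ^^^ 2 ^ u) ||| B else [t]

/-- The bistellar move that replaces `A` by `B` is possible and does not affect points supported
in `z`. -/
def movable (n z A B : ℕ) (L : List ℕ) : Bool :=
  A < 2 ^ n && B < 2 ^ n && A &&& B == 0 && A &&& z != A && B &&& z != B &&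
  L.all fun t => B &&& t != B && (A &&& t != A || (bitList n B).all fun w =>
    L.any fun t' => ((t ||| B) ^^^ 2 ^ w) &&& t' == (t ||| B) ^^^ 2 ^ w)

/-- Evaluate a natural number before passing it to a function. -/
def evalNat {α : Type*} (a : ℕ) (f : ℕ → α) : α :=
  match a with
  | 0 => f 0
  | k + 1 => f (k + 1)

lemma evalNat_eq {α : Type*} (a : ℕ) (f : ℕ → α) : evalNat a f = f a := by
  cases a <;> rfl

/-- Evaluate a list of natural numbers before passing it to a function. -/
def evalList {α : Type*} : List ℕ → (List ℕ → α) → α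
  | [], f => f []
  | a :: l, f => evalNat a fun a' => evalList l fun l' => f (a' :: l')

lemma evalList_eq {α : Type*} (l : List ℕ) (f : List ℕ → α) : evalList l f = f l := by
  induction l generalizing f with
  | nil => rfl
  | cons a l ih => rw [evalList, evalNat_eq, ih]

/-- Perform a list of bistellar moves. -/
def run (n z : ℕ) : List (ℕ × ℕ) → List ℕ → Option (List ℕ)
  | [], L => some L
  | (A, B) :: M, L => evalNat A fun A => evalNat B fun B =>
    if movable n z A B L then evalList (move n A B L) fun L' => run n z M L' else none

lemma mem_move {A B : ℕ} {L : List ℕ} {m : ℕ} : m ∈ move n A B L ↔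
    (m ∈ L ∧ A &&& m ≠ A) ∨ ∃ t ∈ L, A &&& t = A ∧ ∃ u ∈ bitList n A, (t ^^^ 2 ^ u) ||| B = m := by
  simp only [move, List.mem_flatMap]
  constructor
  · rintro ⟨t, ht, h⟩
    split_ifs at h with hA
    · obtain ⟨u, hu, h⟩ := List.mem_map.1 h
      exact Or.inr ⟨t, ht, hA, u, hu, h⟩
    · rw [List.mem_singleton] at h
      exact Or.inl ⟨h ▸ ht, h ▸ hA⟩
  · rintro (⟨h, hA⟩ | ⟨t, ht, hA, u, hu, h⟩)
    · exact ⟨m, h, by simp [hA]⟩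
    · exact ⟨t, ht, by rw [if_pos hA]; exact List.mem_map.2 ⟨u, hu, h⟩⟩

/-- The homeomorphism fixes the points supported in the vertex set `z`. -/
def FixesSupportedIn (z : ℕ) {X Y : Set (Fin n → ℝ)} (e : X ≃ₜ Y) : Prop :=
  (∀ x : X, (∀ v, x.1 v ≠ 0 → z.testBit v = true) → (e x).1 = x.1) ∧
    ∀ y : Y, (∀ v, y.1 v ≠ 0 → z.testBit v = true) → (e.symm y).1 = y.1

lemma exists_homeomorph_move {z A B : ℕ} {L : List ℕ} (h : movable n z A B L = true) :
    ∃ e : carrier (facets n L) ≃ₜ carrier (facets n (move n A B L)), FixesSupportedIn z e := by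
  simp only [movable, Bool.and_eq_true, decide_eq_true_eq, beq_iff_eq, bne_iff_ne, ne_eq,
    List.all_eq_true, Bool.or_eq_true, List.any_eq_true] at h
  obtain ⟨⟨⟨⟨⟨hAn, hBn⟩, hAB⟩, hAz⟩, hBz⟩, hL⟩ := h
  have hA : (bits n A).Nonempty := bits_nonempty hAn fun h0 => hAz (by simp [h0])
  have hB : (bits n B).Nonempty := bits_nonempty hBn fun h0 => hBz (by simp [h0])
  have hdis : Disjoint (bits n A) (bits n B) := by
    refine disjoint_left.2 fun v h1 h2 => ?_
    have h3 : (A &&& B).testBit v = true := by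
      rw [Nat.testBit_and, mem_bits.1 h1, mem_bits.1 h2]; rfl
    simp [hAB] at h3
  have hnewB : ∀ t u, bits n B ⊆ bits n ((t ^^^ 2 ^ u) ||| B) := fun t u v hv => by
    rw [mem_bits] at hv ⊢
    simp [Nat.testBit_or, hv]
  have hFG : MovesTo (bits n A) (bits n B) (facets n L) (facets n (move n A B L)) := by
    refine ⟨?_, ?_, ?_⟩
    · rintro _ ⟨t, ht, rfl⟩ hsub
      exact (hL t ht).1 (land_eq_of_bits_subset hBn hsub)
    · rintro _ ⟨t, ht, rfl⟩ hsub
      exact ⟨_, ⟨t, mem_move.2 (Or.inl ⟨ht, fun h => hsub (bits_mono h)⟩), rfl⟩, Subset.rfl⟩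
    · rintro _ ⟨t, ht, rfl⟩ hsub u hu
      refine ⟨_, ⟨(t ^^^ 2 ^ (u : ℕ)) ||| B, mem_move.2 (Or.inr ⟨t, ht,
        land_eq_of_bits_subset hAn hsub, u, mem_bitList hu, rfl⟩), rfl⟩, ?_⟩
      refine union_subset (fun v hv => ?_) (hnewB _ _)
      obtain ⟨h1, h2⟩ := mem_erase.1 hv
      have := mem_bits.1 ((mem_bits_xor (hsub hu)).2 ⟨h2, h1⟩)
      rw [mem_bits, Nat.testBit_or, this, Bool.true_or]
  have hGF : MovesTo (bits n B) (bits n A) (facets n (move n A B L)) (facets n L) := by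
    refine ⟨?_, ?_, ?_⟩
    · rintro _ ⟨m, hm, rfl⟩ hsub
      rcases mem_move.1 hm with ⟨-, h⟩ | ⟨t, ht, hAt, i, hi, rfl⟩
      · exact h (land_eq_of_bits_subset hAn hsub)
      · obtain ⟨u, hu, rfl⟩ := exists_fin_of_mem_bitList hi
        have h1 := mem_bits.1 (hsub hu)
        rw [Nat.testBit_or, Bool.or_eq_true] at h1
        rcases h1 with h1 | h1
        · exact ((mem_bits_xor (bits_mono hAt hu)).1 (mem_bits.2 h1)).2 rfl
        · exact disjoint_left.1 hdis hu (mem_bits.2 h1)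
    · rintro _ ⟨m, hm, rfl⟩ hsub
      rcases mem_move.1 hm with ⟨h, -⟩ | ⟨t, ht, hAt, i, hi, rfl⟩
      · exact ⟨_, ⟨m, h, rfl⟩, Subset.rfl⟩
      · exact absurd (hnewB _ _) hsub
    · rintro _ ⟨m, hm, rfl⟩ hsub w hw
      rcases mem_move.1 hm with ⟨h, -⟩ | ⟨t, ht, hAt, i, hi, rfl⟩
      · exact absurd (land_eq_of_bits_subset hBn hsub) (hL m h).1
      · obtain ⟨u, hu, rfl⟩ := exists_fin_of_mem_bitList hi
        obtain ⟨t', ht', h'⟩ := ((hL t ht).2.resolve_left (not_not.2 hAt)) w (mem_bitList hw)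
        refine ⟨_, ⟨t', ht', rfl⟩, subset_trans (fun v hv => ?_) (bits_mono h')⟩
        have hor : ∀ {v : Fin n}, v ∈ bits n (t ||| B) ↔ v ∈ bits n t ∨ v ∈ bits n B := by
          simp [Nat.testBit_or]
        rw [mem_bits_xor (hor.2 (Or.inr hw)), hor]
        rcases mem_union.1 hv with hv | hv
        · obtain ⟨h1, h2⟩ := mem_erase.1 hv
          rw [mem_bits, Nat.testBit_or, Bool.or_eq_true] at h2
          refine ⟨?_, h1⟩
          rcases h2 with h2 | h2
          · exact Or.inl ((mem_bits_xor (bits_mono hAt hu)).1 (mem_bits.2 h2)).1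
          · exact Or.inr (mem_bits.2 h2)
        · exact ⟨Or.inl (bits_mono hAt hv), fun h => disjoint_left.1 hdis hv (h ▸ hw)⟩
  have hfix : ∀ {C : ℕ} (hCn : C < 2 ^ n) (hC : (bits n C).Nonempty), ¬ C &&& z = C →
      ∀ x : Fin n → ℝ, (∀ v, 0 ≤ x v) → (∀ v, x v ≠ 0 → z.testBit v = true) →
      (bits n C).inf' hC x = 0 := by
    intro C hCn hC hCz x h0 hx
    obtain ⟨u, hu, huz⟩ := not_subset.1 fun hsub => hCz (land_eq_of_bits_subset hCn hsub)
    refine inf'_eq_zero hC h0 hu ?_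
    by_contra hne
    exact huz (mem_bits.2 (hx u hne))
  exact ⟨bistellarHomeomorph hA hB hdis hFG hGF,
    fun x hx => exchange_eq_self _ hA (hfix hAn hA hAz x.1 x.2.1 hx),
    fun y hy => exchange_eq_self _ hB (hfix hBn hB hBz y.1 y.2.1 hy)⟩

theorem exists_homeomorph_run {z : ℕ} : ∀ {M : List (ℕ × ℕ)} {L L' : List ℕ},
    run n z M L = some L' →
    ∃ e : carrier (facets n L) ≃ₜ carrier (facets n L'), FixesSupportedIn z e
  | [], L, L', h => by
    obtain rfl : L = L' := by simpa [run] using h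
    exact ⟨Homeomorph.refl _, fun x _ => rfl, fun y _ => rfl⟩
  | (A, B) :: M, L, L', h => by
    rw [run, evalNat_eq, evalNat_eq, evalList_eq] at h
    split_ifs at h with hm
    obtain ⟨e, he⟩ := exists_homeomorph_move hm
    obtain ⟨f, hf⟩ := exists_homeomorph_run h
    refine ⟨e.trans f, fun x hx => ?_, fun y hy => ?_⟩
    · have h1 := he.1 x hx
      exact (hf.1 (e x) (by rwa [h1])).trans h1
    · have h1 := hf.2 y hy
      exact (he.2 (f.symm y) (by rwa [h1])).trans h1

end Masks

/-! ### Simplicial maps -/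

lemma single_add_single_eq {V : Type*} [DecidableEq V] {a b a' b' : V} {s s' : ℝ}
    (hab : a ≠ b) (hab' : a' ≠ b')
    (h : (Pi.single a (1 - s) + Pi.single b s : V → ℝ) = Pi.single a' (1 - s') + Pi.single b' s') :
    (s = 0 ∧ s' = 0 ∧ a = a') ∨ (s = 0 ∧ s' = 1 ∧ a = b') ∨ (s = 1 ∧ s' = 0 ∧ b = a') ∨
      (s = 1 ∧ s' = 1 ∧ b = b') ∨ (a = a' ∧ b = b' ∧ s = s') ∨ (a = b' ∧ b = a') := by
  have ha := congrFun h a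
  have hb := congrFun h b
  have ha' := congrFun h a'
  have hb' := congrFun h b'
  simp only [Pi.add_apply, Pi.single_apply] at ha hb ha' hb'
  grind

section Push

variable {V W : Type*} [Fintype V] [DecidableEq W]

/-- The map on barycentric coordinates induced by a map of the vertices. -/
def push (π : V → W) (x : V → ℝ) : W → ℝ := fun w => ∑ v, if π v = w then x v else 0

lemma continuous_push (π : V → W) : Continuous (push π) := by
  refine continuous_pi fun w => continuous_finsetSum _ fun v _ => ?_
  split_ifs
  · exact continuous_apply v
  · exact continuous_const

lemma push_add (π : V → W) (x y : V → ℝ) : push π (x + y) = push π x + push π y := by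
  funext w
  simp only [push, Pi.add_apply, ← sum_add_distrib]
  exact sum_congr rfl fun v _ => by split_ifs <;> simp

lemma push_single [DecidableEq V] (π : V → W) (a : V) (c : ℝ) :
    push π (Pi.single a c) = Pi.single (π a) c := by
  funext w
  rw [push, sum_eq_single a]
  · simp [Pi.single_apply, eq_comm]
  · intro b _ hb
    simp [hb]
  · simp

lemma push_apply_of_injOn {π : V → W} {x : V → ℝ} {t : Finset V} (hx : ∀ v, x v ≠ 0 → v ∈ t)
    (hπ : Set.InjOn π t) {v : V} (hv : v ∈ t) : push π x (π v) = x v := by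
  rw [push, sum_eq_single v]
  · simp
  · intro b _ hb
    split_ifs with h
    · by_contra hne
      exact hb (hπ (hx b hne) hv h)
    · rfl
  · simp

lemma eq_of_push_eq [DecidableEq V] {π : V → W} {F : Set (Finset V)} {u : V}
    (hu : ∀ v, π v = π u → v = u)
    (hstar : ∀ t ∈ F, ∀ t' ∈ F, u ∈ t → u ∈ t' → Set.InjOn π ↑(t ∪ t')) {x y : V → ℝ}
    (hx : x ∈ carrier F) (hy : y ∈ carrier F) (h : push π x = push π y) (hxu : x u ≠ 0) :
    x = y := by
  have hpu : ∀ z : V → ℝ, push π z (π u) = z u := fun z => by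
    rw [push, sum_eq_single u]
    · simp
    · intro b _ hb
      rw [if_neg fun h => hb (hu b h)]
    · simp
  have hyu : y u ≠ 0 := by rwa [← hpu y, ← h, hpu x]
  obtain ⟨-, -, t, ht, hs⟩ := hx
  obtain ⟨-, -, t', ht', hs'⟩ := hy
  have hinj := hstar t ht t' ht' (hs u hxu) (hs' u hyu)
  have h1 : ∀ v, x v ≠ 0 → v ∈ t ∪ t' := fun v hv => mem_union_left _ (hs v hv)
  have h2 : ∀ v, y v ≠ 0 → v ∈ t ∪ t' := fun v hv => mem_union_right _ (hs' v hv)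
  funext v
  by_cases hv : v ∈ t ∪ t'
  · rw [← push_apply_of_injOn h1 hinj hv, h, push_apply_of_injOn h2 hinj hv]
  · rw [not_not.1 fun hne => hv (h1 v hne), not_not.1 fun hne => hv (h2 v hne)]

variable [Fintype W]

lemma push_mem_carrier {π : V → W} {F : Set (Finset V)} {x : V → ℝ} (hx : x ∈ carrier F) :
    push π x ∈ carrier ((fun t => t.image π) '' F) := by
  obtain ⟨h0, h1, t, ht, hs⟩ := hx
  refine ⟨fun w => sum_nonneg fun v _ => ?_, ?_, _, ⟨t, ht, rfl⟩, fun w hw => ?_⟩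
  · split_ifs
    exacts [h0 v, le_rfl]
  · simp only [push]
    rw [sum_comm]
    simpa using h1
  · obtain ⟨v, -, hv⟩ := exists_ne_zero_of_sum_ne_zero hw
    have hvw : π v = w := by
      by_contra hne
      simp [hne] at hv
    rw [if_pos hvw] at hv
    exact hvw ▸ mem_image_of_mem π (hs v hv)

lemma exists_push_eq [DecidableEq V] {π : V → W} {F : Set (Finset V)}
    (hπ : ∀ t ∈ F, Set.InjOn π t) {y : W → ℝ}
    (hy : y ∈ carrier ((fun t => t.image π) '' F)) : ∃ x ∈ carrier F, push π x = y := by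
  obtain ⟨h0, h1, _, ⟨t, ht, rfl⟩, hs⟩ := hy
  have hx : ∀ v, (if v ∈ t then y (π v) else 0) ≠ 0 → v ∈ t := fun v hv => by
    by_contra hne
    simp [hne] at hv
  refine ⟨fun v => if v ∈ t then y (π v) else 0, ⟨fun v => ?_, ?_, t, ht, hx⟩, ?_⟩
  · dsimp only
    split_ifs
    exacts [h0 _, le_rfl]
  · rw [sum_ite_mem, univ_inter, ← sum_image (f := y) (hπ t ht), ← h1]
    refine sum_subset (subset_univ _) fun w _ hw => ?_
    by_contra hne
    exact hw (hs w hne)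
  · funext w
    by_cases hw : w ∈ t.image π
    · obtain ⟨v, hv, rfl⟩ := mem_image.1 hw
      rw [push_apply_of_injOn hx (hπ t ht) hv, if_pos hv]
    · have hyw : y w = 0 := by
        by_contra hne
        exact hw (hs w hne)
      rw [hyw]
      refine sum_eq_zero fun v _ => ?_
      by_cases h2 : v ∈ t
      · rw [if_neg]
        rintro rfl
        exact hw (mem_image_of_mem π h2)
      · simp [h2]

end Push

/-! ### A triangulated disc and its quotient -/

/-- The cone with apex `60` over the cycle `0, …, 29`. -/
def coneFacets : List ℕ := (List.range 30).map fun j => 2 ^ 60 + 2 ^ j + 2 ^ ((j + 1) % 30)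

/-- The edges from the apex of the cone, with the vertices that subdivide them. -/
def ringMoves : List (ℕ × ℕ) := (List.range 30).map fun j => (2 ^ 60 + 2 ^ j, 2 ^ (30 + j))

/-- The subdivision of the cone at the edges from its apex. -/
def discFacets : List ℕ := (List.range 30).flatMap fun j =>
  [2 ^ 60 + 2 ^ (30 + j) + 2 ^ (30 + (j + 1) % 30),
    2 ^ min 29 (j + 1) + 2 ^ (30 + j) + 2 ^ (30 + (j + 1) % 30),
    2 ^ j + 2 ^ ((j + 1) % 30) + 2 ^ (30 + if j = 29 then 0 else j)]

lemma run_ringMoves : run 61 (2 ^ 30 - 1) ringMoves coneFacets = some discFacets := by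
  decide +kernel

/-- The identifications on the boundary of the disc. -/
def glueNat (v : ℕ) : ℕ :=
  if v < 30 then if v % 3 = 0 then 0 else 2 * (v / 6) + v % 3 else v - 19

lemma glueNat_lt {v : ℕ} (hv : v < 61) : glueNat v < 42 := by
  unfold glueNat
  split_ifs <;> omega

/-- The identifications on the boundary of the disc, as a map of the vertices. -/
def glue (v : Fin 61) : Fin 42 := ⟨glueNat v, glueNat_lt v.2⟩

lemma glue_eq_of_le {u v : Fin 61} (hu : 30 ≤ u.val) (h : glue v = glue u) : v = u := by
  have h1 : glueNat v = glueNat u := congrArg Fin.val h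
  apply Fin.ext
  unfold glueNat at h1
  split_ifs at h1 <;> omega

/-- The union of the facets that contain a vertex. -/
def starMask (L : List ℕ) (u : ℕ) : ℕ := (L.filter fun m => m.testBit u).foldr (· ||| ·) 0

lemma testBit_starMask {L : List ℕ} {u m v : ℕ} (hm : m ∈ L) (hu : m.testBit u = true)
    (hv : m.testBit v = true) : (starMask L u).testBit v = true := by
  have h : ∀ l : List ℕ, m ∈ l → (l.foldr (· ||| ·) 0).testBit v = true := by
    intro l
    induction l with
    | nil => simp
    | cons a l ih =>
      intro hml
      rw [List.foldr_cons, Nat.testBit_or, Bool.or_eq_true]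
      rcases List.mem_cons.1 hml with rfl | hml
      · exact Or.inl hv
      · exact Or.inr (ih hml)
  exact h _ (List.mem_filter.2 ⟨hm, hu⟩)

lemma nodup_glueNat_star : ((List.range 31).all fun i =>
    decide ((bitList 61 (starMask discFacets (30 + i))).map glueNat).Nodup) = true := by
  decide +kernel

lemma nodup_glueNat_facet : (discFacets.all fun m =>
    decide ((bitList 61 m).map glueNat).Nodup) = true := by
  decide +kernel

lemma glue_injOn {m : ℕ} (h : ((bitList 61 m).map glueNat).Nodup) :
    Set.InjOn glue (bits 61 m) := fun _ hv _ hw hvw =>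
  Fin.ext (List.inj_on_of_nodup_map h (mem_bitList hv) (mem_bitList hw) (congrArg Fin.val hvw))

lemma glue_injOn_facet : ∀ t ∈ facets 61 discFacets, Set.InjOn glue t := by
  rintro _ ⟨m, hm, rfl⟩
  exact glue_injOn (of_decide_eq_true (List.all_eq_true.1 nodup_glueNat_facet m hm))

lemma glue_injOn_star {u : Fin 61} (hu : 30 ≤ u.val) : ∀ t ∈ facets 61 discFacets,
    ∀ t' ∈ facets 61 discFacets, u ∈ t → u ∈ t' → Set.InjOn glue ↑(t ∪ t') := by
  rintro _ ⟨m, hm, rfl⟩ _ ⟨m', hm', rfl⟩ h h'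
  have h1 := List.all_eq_true.1 nodup_glueNat_star (u.val - 30) (List.mem_range.2 (by omega))
  rw [Nat.add_sub_cancel' hu] at h1
  refine (glue_injOn (of_decide_eq_true h1)).mono fun v hv => ?_
  rcases mem_union.1 (mem_coe.1 hv) with hv | hv
  · exact mem_bits.2 (testBit_starMask hm (mem_bits.1 h) (mem_bits.1 hv))
  · exact mem_bits.2 (testBit_starMask hm' (mem_bits.1 h') (mem_bits.1 hv))

/-- The facets of the quotient of the disc. -/
def hubFacets : List ℕ :=
  discFacets.map fun m => (bitList 61 m).foldr (fun v a => 2 ^ glueNat v ||| a) 0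

lemma facets_hubFacets : facets 42 hubFacets = (fun t => t.image glue) '' facets 61 discFacets := by
  have h : ∀ m, bits 42 ((bitList 61 m).foldr (fun v a => 2 ^ glueNat v ||| a) 0) =
      (bits 61 m).image glue := by
    intro m
    have h1 : ∀ (l : List ℕ) (w : ℕ),
        (l.foldr (fun v a => 2 ^ glueNat v ||| a) 0).testBit w = true ↔
        ∃ v ∈ l, glueNat v = w := by
      intro l w
      induction l with
      | nil => simp
      | cons a l ih => simp [Nat.testBit_or, Nat.testBit_two_pow, ih]
    ext w
    rw [mem_bits, h1, mem_image]
    constructor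
    · rintro ⟨i, hi, hw⟩
      obtain ⟨v, hv, rfl⟩ := exists_fin_of_mem_bitList hi
      exact ⟨v, hv, Fin.ext hw⟩
    · rintro ⟨v, hv, rfl⟩
      exact ⟨v, mem_bitList hv, rfl⟩
  ext t
  simp only [facets, hubFacets, Set.mem_ofPred_eq, Set.mem_image, List.mem_map]
  constructor
  · rintro ⟨_, ⟨m, hm, rfl⟩, rfl⟩
    exact ⟨_, ⟨m, hm, rfl⟩, (h m).symm⟩
  · rintro ⟨_, ⟨m, hm, rfl⟩, rfl⟩
    exact ⟨_, ⟨m, hm, rfl⟩, h m⟩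

/-! ### The polygonal normal form -/

/-- The vertices on the boundary of the disc. -/
def rim (j : ℕ) : Fin 61 := ⟨j % 30, by omega⟩

/-- The map from polar coordinates (with angles in units of `2π/30`) to the cone. -/
noncomputable def wheel (r φ : ℝ) : Fin 61 → ℝ := fun v =>
  if v.val < 30 then
    r * (max 0 (1 - |φ - v.val|) + if v.val = 0 then max 0 (1 - |φ - 30|) else 0)
  else if v.val = 60 then 1 - r else 0

lemma continuous_wheel : Continuous fun p : ℝ × ℝ => wheel p.1 p.2 := by
  refine continuous_pi fun v => ?_
  unfold wheel
  split_ifs <;> fun_prop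

lemma tent_eq {j v : ℕ} {s : ℝ} (h0 : 0 ≤ s) (h1 : s ≤ 1) :
    max 0 (1 - |(j + s : ℝ) - v|) =
      (if v = j then 1 - s else 0) + if v = j + 1 then s else 0 := by
  rcases lt_trichotomy v j with h | h | h
  · have : (v : ℝ) + 1 ≤ j := by exact_mod_cast h
    rw [if_neg (by omega), if_neg (by omega), abs_of_nonneg (by linarith),
      max_eq_left (by linarith), add_zero]
  · subst h
    rw [if_pos rfl, if_neg (by omega), abs_of_nonneg (by linarith), max_eq_right (by linarith)]
    ring
  · have hv : (j : ℝ) + 1 ≤ v := by exact_mod_cast h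
    rw [if_neg (by omega), abs_of_nonpos (by linarith)]
    split_ifs with h2
    · rw [h2, max_eq_right (by push_cast; linarith)]
      push_cast
      ring
    · have : (j : ℝ) + 2 ≤ v := by exact_mod_cast (by omega : j + 2 ≤ v)
      rw [max_eq_left (by linarith), add_zero]

lemma wheel_eq (r : ℝ) {j : ℕ} (hj : j < 30) {s : ℝ} (h0 : 0 ≤ s) (h1 : s ≤ 1) :
    wheel r (j + s) =
      Pi.single (rim j) (r * (1 - s)) + Pi.single (rim (j + 1)) (r * s) + Pi.single 60 (1 - r) := by
  have h30 : (30 : ℝ) = ((30 : ℕ) : ℝ) := by norm_num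
  funext v
  have e1 : v = rim j ↔ v.val = j := by 
    rw [Fin.ext_iff]
    simp only [rim, Nat.mod_eq_of_lt hj]
  have e2 : v = rim (j + 1) ↔ v.val = (j + 1) % 30 := by rw [Fin.ext_iff, rim]
  have e3 : v = 60 ↔ v.val = 60 := by rw [Fin.ext_iff]; rfl
  simp only [wheel, Pi.add_apply, Pi.single_apply, e1, e2, e3, h30, tent_eq h0 h1]
  have hv := v.2
  generalize v.val = w at *
  by_cases hw : w < 30
  · rw [if_pos hw, if_neg (by omega : ¬ w = 60), add_zero]
    by_cases a1 : w = j
    · subst a1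
      rw [if_pos rfl, if_neg (by omega : ¬ w = w + 1), if_pos rfl,
        if_neg (by omega : ¬ w = (w + 1) % 30)]
      split_ifs <;> first | omega | ring
    · rw [if_neg a1, if_neg a1]
      split_ifs <;> first | omega | ring
  · rw [if_neg hw, if_neg (by omega : ¬ w = j), if_neg (by omega : ¬ w = (j + 1) % 30)]
    simp

lemma exists_nat_add {φ : ℝ} (h0 : 0 ≤ φ) (h1 : φ ≤ 30) :
    ∃ j < 30, ∃ s : ℝ, 0 ≤ s ∧ s ≤ 1 ∧ φ = (j : ℕ) + s := by
  rcases h1.lt_or_eq with h | h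
  · refine ⟨⌊φ⌋₊, ?_, φ - ⌊φ⌋₊, sub_nonneg.2 (Nat.floor_le h0), ?_, by ring⟩
    · exact (Nat.floor_lt h0).2 (by exact_mod_cast h)
    · linarith [Nat.lt_floor_add_one φ]
  · exact ⟨29, by norm_num, 1, zero_le_one, le_rfl, by rw [h]; norm_num⟩

lemma rim_ne {j : ℕ} : rim j ≠ rim (j + 1) := by
  rw [Ne, Fin.ext_iff]
  simp only [rim]
  omega

lemma rim_ne_apex (j : ℕ) : rim j ≠ 60 := by
  rw [Ne, Fin.ext_iff]
  change j % 30 ≠ 60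
  omega

lemma mem_bits_cone : ∀ j < 30, ∀ v : Fin 61,
    v ∈ bits 61 (2 ^ 60 + 2 ^ j + 2 ^ ((j + 1) % 30)) ↔ v = 60 ∨ v = rim j ∨ v = rim (j + 1) := by
  simp only [mem_bits]
  decide +kernel

lemma wheel_mem {r φ : ℝ} (hr0 : 0 ≤ r) (hr1 : r ≤ 1) (h0 : 0 ≤ φ) (h1 : φ ≤ 30) :
    wheel r φ ∈ carrier (facets 61 coneFacets) := by
  obtain ⟨j, hj, s, hs0, hs1, rfl⟩ := exists_nat_add h0 h1
  rw [wheel_eq r hj hs0 hs1]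
  refine ⟨fun v => ?_, ?_, _, ⟨_, List.mem_map.2 ⟨j, List.mem_range.2 hj, rfl⟩, rfl⟩,
    fun v hv => ?_⟩
  · have : 0 ≤ r * (1 - s) := mul_nonneg hr0 (by linarith)
    have : 0 ≤ r * s := mul_nonneg hr0 hs0
    have : 0 ≤ 1 - r := by linarith
    simp only [Pi.add_apply, Pi.single_apply]
    positivity
  · simp only [Pi.add_apply, sum_add_distrib, sum_pi_single', mem_univ, if_true]
    ring
  · rw [mem_bits_cone j hj]
    by_contra hcon
    simp only [not_or] at hcon
    exact hv (by simp [hcon])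

lemma exists_wheel_eq {x : Fin 61 → ℝ} (hx : x ∈ carrier (facets 61 coneFacets)) :
    ∃ r φ : ℝ, (0 ≤ r ∧ r ≤ 1) ∧ (0 ≤ φ ∧ φ ≤ 30) ∧ wheel r φ = x := by
  obtain ⟨h0, h1, _, ⟨m, hm, rfl⟩, hs⟩ := hx
  obtain ⟨j, hj, rfl⟩ := List.mem_map.1 hm
  rw [List.mem_range] at hj
  have hx : x = Pi.single (rim j) (x (rim j)) + Pi.single (rim (j + 1)) (x (rim (j + 1))) +
      Pi.single 60 (x 60) := by
    funext v
    simp only [Pi.add_apply, Pi.single_apply]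
    by_cases hv1 : v = rim j
    · subst hv1
      simp [rim_ne, rim_ne_apex]
    · by_cases hv2 : v = rim (j + 1)
      · subst hv2
        simp [rim_ne.symm, rim_ne_apex]
      · by_cases hv3 : v = 60
        · subst hv3
          simp [(rim_ne_apex _).symm]
        · rw [if_neg hv1, if_neg hv2, if_neg hv3]
          by_contra hne
          have := (mem_bits_cone j hj v).1 (hs v (by simpa using hne))
          tauto
  have hsum : x (rim j) + x (rim (j + 1)) + x 60 = 1 := by
    rw [hx] at h1
    simpa only [Pi.add_apply, sum_add_distrib, sum_pi_single', mem_univ, if_true] using h1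
  have ha := h0 (rim j)
  have hb := h0 (rim (j + 1))
  have hc := h0 60
  generalize x (rim j) = a at *
  generalize x (rim (j + 1)) = b at *
  generalize x 60 = c at *
  have hj' : (j : ℝ) + 1 ≤ 30 := by exact_mod_cast hj
  have hab : 0 ≤ a + b := by linarith
  have hs0 : 0 ≤ b / (a + b) := by positivity
  have hs1 : b / (a + b) ≤ 1 := div_le_one_of_le₀ (by linarith) hab
  refine ⟨a + b, j + b / (a + b), ⟨hab, by linarith⟩, ⟨by positivity, by linarith⟩, ?_⟩
  have e1 : (a + b) * (b / (a + b)) = b := by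
    rcases hab.eq_or_lt with h | h
    · have : b = 0 := by linarith
      simp [this]
    · field_simp
  rw [wheel_eq _ hj hs0 hs1, mul_sub, e1, mul_one, add_sub_cancel_right, hx]
  congr 2
  linarith

/-- Points of the closed disc in polar coordinates, with angles in units of `2π/30`. -/
noncomputable def polar (r φ : ℝ) : ℂ := r * Complex.exp (2 * Real.pi * Complex.I * (φ / 30))

lemma continuous_polar : Continuous fun p : ℝ × ℝ => polar p.1 p.2 := by
  unfold polar
  fun_prop

lemma polar_eq_exp (r φ : ℝ) :
    polar r φ = r * Complex.exp ((2 * Real.pi * (φ / 30) : ℝ) * Complex.I) := by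
  rw [polar]
  congr 2
  push_cast
  ring

lemma norm_polar {r : ℝ} (hr : 0 ≤ r) (φ : ℝ) : ‖polar r φ‖ = r := by
  rw [polar_eq_exp, norm_mul, Complex.norm_exp_ofReal_mul_I, Complex.norm_real, mul_one,
    Real.norm_of_nonneg hr]

lemma polar_add_thirty (r φ : ℝ) : polar r (φ + 30) = polar r φ := by
  rw [polar, polar]
  congr 1
  rw [Complex.exp_eq_exp_iff_exists_int]
  refine ⟨1, ?_⟩
  push_cast
  ring

lemma exists_polar_eq {z : ℂ} (hz : ‖z‖ ≤ 1) :
    ∃ r φ : ℝ, (0 ≤ r ∧ r ≤ 1) ∧ (0 ≤ φ ∧ φ ≤ 30) ∧ polar r φ = z := by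
  have h1 := Complex.norm_mul_exp_arg_mul_I z
  have hpi := Real.pi_pos
  have h2 := Complex.neg_pi_lt_arg z
  have h3 := Complex.arg_le_pi z
  have hp : polar ‖z‖ (z.arg / (2 * Real.pi) * 30) = z := by
    have e : 2 * Real.pi * (z.arg / (2 * Real.pi) * 30 / 30) = z.arg := by field_simp
    rw [polar_eq_exp, e, h1]
  rcases le_or_gt 0 z.arg with h | h
  · refine ⟨‖z‖, _, ⟨norm_nonneg z, hz⟩, ⟨by positivity, ?_⟩, hp⟩
    have : z.arg / (2 * Real.pi) ≤ 1 := by rw [div_le_one (by positivity)]; linarith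
    linarith
  · refine ⟨‖z‖, z.arg / (2 * Real.pi) * 30 + 30, ⟨norm_nonneg z, hz⟩, ⟨?_, ?_⟩,
      (polar_add_thirty _ _).trans hp⟩
    · have : -1 ≤ z.arg / (2 * Real.pi) := by rw [le_div_iff₀ (by positivity)]; linarith
      linarith
    · have : z.arg / (2 * Real.pi) ≤ 0 := div_nonpos_of_nonpos_of_nonneg h.le (by positivity)
      linarith

lemma wheel_zero_left (φ φ' : ℝ) : wheel 0 φ = wheel 0 φ' := by
  funext v
  simp [wheel]

lemma wheel_thirty (r : ℝ) : wheel r 30 = wheel r 0 := by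
  have h1 := wheel_eq r (j := 29) (by norm_num) zero_le_one le_rfl
  have h2 := wheel_eq r (j := 0) (by norm_num) le_rfl zero_le_one
  have e1 : ((29 : ℕ) : ℝ) + 1 = 30 := by norm_num
  have e2 : ((0 : ℕ) : ℝ) + 0 = 0 := by norm_num
  rw [e1] at h1
  rw [e2] at h2
  rw [h1, h2]
  have : rim (29 + 1) = rim 0 := rfl
  rw [this]
  simp

lemma wheel_eq_of_polar_eq {r φ r' φ' : ℝ} (hr : 0 ≤ r) (hr' : 0 ≤ r') (h0 : 0 ≤ φ) (h1 : φ ≤ 30)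
    (h0' : 0 ≤ φ') (h1' : φ' ≤ 30) (h : polar r φ = polar r' φ') : wheel r φ = wheel r' φ' := by
  obtain rfl : r = r' := by rw [← norm_polar hr φ, h, norm_polar hr']
  rcases hr.eq_or_lt with rfl | hr0
  · exact wheel_zero_left _ _
  rw [polar, polar] at h
  have h2 := mul_left_cancel₀ (Complex.ofReal_ne_zero.2 hr0.ne') h
  obtain ⟨n, hn⟩ := Complex.exp_eq_exp_iff_exists_int.1 h2
  have hn' : φ = φ' + 30 * n := by
    have hpi : (2 * Real.pi * Complex.I : ℂ) ≠ 0 := Complex.two_pi_I_ne_zero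
    have h3 : (2 * Real.pi * Complex.I : ℂ) * (φ / 30) =
        (2 * Real.pi * Complex.I : ℂ) * (φ' / 30 + n) := by rw [hn]; ring
    have h4 := mul_left_cancel₀ hpi h3
    have h5 : (φ : ℂ) = ((φ' + 30 * n : ℝ) : ℂ) := by
      push_cast
      linear_combination 30 * h4
    exact_mod_cast h5
  have hn1 : (n : ℝ) ≤ 1 := by linarith
  have hn2 : (-1 : ℝ) ≤ n := by linarith
  have hn3 : n ≤ 1 := by exact_mod_cast hn1
  have hn4 : -1 ≤ n := by exact_mod_cast hn2
  obtain rfl | rfl | rfl : n = -1 ∨ n = 0 ∨ n = 1 := by omega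
  · have e1 : φ = 0 := by push_cast at hn'; linarith
    have e2 : φ' = 30 := by push_cast at hn'; linarith
    rw [e1, e2, wheel_thirty]
  · simp [hn']
  · have e1 : φ = 30 := by push_cast at hn'; linarith
    have e2 : φ' = 0 := by push_cast at hn'; linarith
    rw [e1, e2, wheel_thirty]

lemma polar_natCast_mod (r : ℝ) {j : ℕ} (hj : j ≤ 30) : polar r (j % 30 : ℕ) = polar r j := by
  rcases hj.lt_or_eq with h | rfl
  · rw [Nat.mod_eq_of_lt h]
  · have := polar_add_thirty r 0
    simpa using this.symm

lemma polar_eq_of_rim_eq (r : ℝ) {j j' : ℕ} (hj : j ≤ 30) (hj' : j' ≤ 30) (h : rim j = rim j') :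
    polar r j = polar r j' := by
  rw [← polar_natCast_mod r hj, ← polar_natCast_mod r hj']
  have : j % 30 = j' % 30 := congrArg Fin.val h
  rw [this]

lemma polar_eq_of_wheel_eq {r φ r' φ' : ℝ} (h0 : 0 ≤ φ) (h1 : φ ≤ 30) (h0' : 0 ≤ φ')
    (h1' : φ' ≤ 30) (h : wheel r φ = wheel r' φ') : polar r φ = polar r' φ' := by
  obtain rfl : r = r' := by
    have := congrFun h 60
    simp only [wheel] at this
    norm_num at this
    simpa using this
  by_cases hr : r = 0
  · simp [polar, hr]
  obtain ⟨j, hj, s, hs0, hs1, rfl⟩ := exists_nat_add h0 h1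
  obtain ⟨j', hj', s', hs0', hs1', rfl⟩ := exists_nat_add h0' h1'
  rw [wheel_eq r hj hs0 hs1, wheel_eq r hj' hs0' hs1'] at h
  have h2 := add_right_cancel h
  have h3 : ∀ (a b : Fin 61) (s : ℝ), (Pi.single a (r * (1 - s)) + Pi.single b (r * s) : Fin 61 → ℝ)
      = r • (Pi.single a (1 - s) + Pi.single b s) := fun a b s => by
    rw [smul_add, ← Pi.single_smul', ← Pi.single_smul', smul_eq_mul, smul_eq_mul]
  rw [h3, h3] at h2
  have h4 := smul_right_injective _ hr h2
  have c1 : ∀ i : ℕ, ((i + 1 : ℕ) : ℝ) = i + 1 := fun i => by push_cast; rfl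
  rcases single_add_single_eq rim_ne rim_ne h4 with ⟨rfl, rfl, e⟩ | ⟨rfl, rfl, e⟩ | ⟨rfl, rfl, e⟩ |
    ⟨rfl, rfl, e⟩ | ⟨e, -, rfl⟩ | ⟨e, e'⟩
  · simpa using polar_eq_of_rim_eq r hj.le hj'.le e
  · simpa [c1] using polar_eq_of_rim_eq r hj.le hj' e
  · simpa [c1] using polar_eq_of_rim_eq r hj hj'.le e
  · simpa [c1] using polar_eq_of_rim_eq r hj hj' e
  · have e1 : j % 30 = j' % 30 := congrArg Fin.val e
    rw [show j = j' by omega]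
  · have e1 : j % 30 = (j' + 1) % 30 := congrArg Fin.val e
    have e2 : (j + 1) % 30 = j' % 30 := congrArg Fin.val e'
    omega

/-- The class in the surface of a boundary point of the disc. -/
noncomputable def boundaryClass (φ : ℝ) : NonorientableSurface 5 :=
  Quot.mk _ ⟨polar 1 φ, by rw [mem_closedBall_zero_iff, norm_polar zero_le_one]⟩

lemma polar_one_first_arc (k : ℕ) (t : ℝ) : polar 1 (6 * k + 3 * t) =
    Complex.exp (2 * Real.pi * Complex.I * ((2 * k + t) / (2 * (5 : ℕ)))) := by
  rw [polar, Complex.ofReal_one, one_mul]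
  congr 1
  push_cast
  ring

lemma polar_one_second_arc (k : ℕ) (t : ℝ) : polar 1 (6 * k + 3 + 3 * t) =
    Complex.exp (2 * Real.pi * Complex.I * ((2 * k + 1 + t) / (2 * (5 : ℕ)))) := by
  rw [polar, Complex.ofReal_one, one_mul]
  congr 1
  push_cast
  ring

lemma boundaryClass_arc {k : ℕ} (hk : k < 5) {t : ℝ} (h0 : 0 ≤ t) (h1 : t ≤ 1) :
    boundaryClass (6 * k + 3 * t) = boundaryClass (6 * k + 3 + 3 * t) :=
  Quot.sound ⟨⟨k, hk⟩, t, ⟨h0, h1⟩, polar_one_first_arc k t, polar_one_second_arc k t⟩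

lemma boundaryClass_corner {m : ℕ} (hm : m ≤ 10) : boundaryClass (3 * m) = boundaryClass 0 := by
  induction m with
  | zero => simp
  | succ m ih =>
    rw [← ih (by omega)]
    rcases Nat.even_or_odd' m with ⟨k, rfl | rfl⟩
    · have := boundaryClass_arc (k := k) (by omega) le_rfl zero_le_one
      convert this.symm using 2 <;> push_cast <;> ring
    · have := boundaryClass_arc (k := k) (by omega) zero_le_one le_rfl
      convert this.symm using 2 <;> push_cast <;> ring

lemma boundaryClass_edge {j : ℕ} (hj : j < 30) {s : ℝ} (h0 : 0 ≤ s) (h1 : s ≤ 1) :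
    boundaryClass (j + s) = boundaryClass ((6 * (j / 6) + j % 3 : ℕ) + s) := by
  by_cases hlt : j % 6 < 3
  · rw [show 6 * (j / 6) + j % 3 = j by omega]
  · have e : (j : ℝ) = 6 * (j / 6 : ℕ) + 3 + (j % 3 : ℕ) := by
      exact_mod_cast (by omega : j = 6 * (j / 6) + 3 + j % 3)
    have h3 : ((j % 3 : ℕ) : ℝ) ≤ 2 := by exact_mod_cast (by omega : j % 3 ≤ 2)
    have := boundaryClass_arc (k := j / 6) (by omega) (t := ((j % 3 : ℕ) + s) / 3)
      (by positivity) (by linarith)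
    convert this.symm using 2
    · rw [e]
      ring
    · push_cast
      ring

lemma glue_rim : ∀ j < 31, ∀ j' < 31, glue (rim j) = glue (rim j') →
    (j % 3 = 0 ∧ j' % 3 = 0) ∨
      (j < 30 ∧ j' < 30 ∧ 6 * (j / 6) + j % 3 = 6 * (j' / 6) + j' % 3) := by
  decide +kernel

lemma glue_rim_edge : ∀ j < 30, ∀ j' < 30, glue (rim j) = glue (rim j') →
    glue (rim (j + 1)) = glue (rim (j' + 1)) →
    6 * (j / 6) + j % 3 = 6 * (j' / 6) + j' % 3 := by
  decide +kernel

lemma glue_rim_edge_ne : ∀ j < 30, ∀ j' < 30, glue (rim j) = glue (rim (j' + 1)) →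
    glue (rim (j + 1)) ≠ glue (rim j') := by
  decide +kernel

lemma glue_rim_ne : ∀ j < 30, glue (rim j) ≠ glue (rim (j + 1)) := by
  decide +kernel

lemma glue_rim_arc : ∀ k < 5, ∀ e < 4, glue (rim (6 * k + e)) = glue (rim (6 * k + e + 3)) := by
  decide +kernel

lemma boundaryClass_vertex {j j' : ℕ} (hj : j < 31) (hj' : j' < 31)
    (h : glue (rim j) = glue (rim j')) : boundaryClass j = boundaryClass j' := by
  have hc : ∀ {i : ℕ}, i < 31 → i % 3 = 0 → boundaryClass i = boundaryClass 0 := fun {i} hi h => by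
    rw [← boundaryClass_corner (m := i / 3) (by omega)]
    congr 1
    exact_mod_cast (by omega : i = 3 * (i / 3))
  rcases glue_rim j hj j' hj' h with ⟨h1, h2⟩ | ⟨h1, h2, h3⟩
  · rw [hc hj h1, hc hj' h2]
  · have e1 := boundaryClass_edge h1 le_rfl zero_le_one
    have e2 := boundaryClass_edge h2 le_rfl zero_le_one
    rw [add_zero] at e1 e2
    rw [e1, e2, h3]

lemma push_wheel_one {j : ℕ} (hj : j < 30) {s : ℝ} (h0 : 0 ≤ s) (h1 : s ≤ 1) :
    push glue (wheel 1 (j + s)) =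
      Pi.single (glue (rim j)) (1 - s) + Pi.single (glue (rim (j + 1))) s := by
  rw [wheel_eq 1 hj h0 h1, push_add, push_add, push_single, push_single, push_single]
  simp

lemma boundaryClass_eq_of_push_eq {φ φ' : ℝ} (h0 : 0 ≤ φ) (h1 : φ ≤ 30) (h0' : 0 ≤ φ')
    (h1' : φ' ≤ 30) (h : push glue (wheel 1 φ) = push glue (wheel 1 φ')) :
    boundaryClass φ = boundaryClass φ' := by
  obtain ⟨j, hj, s, hs0, hs1, rfl⟩ := exists_nat_add h0 h1
  obtain ⟨j', hj', s', hs0', hs1', rfl⟩ := exists_nat_add h0' h1'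
  rw [push_wheel_one hj hs0 hs1, push_wheel_one hj' hs0' hs1'] at h
  have c1 : ∀ i : ℕ, (i : ℝ) + 1 = (i + 1 : ℕ) := fun i => by push_cast; rfl
  rcases single_add_single_eq (glue_rim_ne j hj) (glue_rim_ne j' hj') h with
    ⟨rfl, rfl, e⟩ | ⟨rfl, rfl, e⟩ | ⟨rfl, rfl, e⟩ | ⟨rfl, rfl, e⟩ | ⟨e, e', rfl⟩ | ⟨e, e'⟩
  · rw [add_zero, add_zero]
    exact boundaryClass_vertex (by omega) (by omega) e
  · rw [add_zero, c1]
    exact boundaryClass_vertex (by omega) (by omega) e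
  · rw [add_zero, c1]
    exact boundaryClass_vertex (by omega) (by omega) e
  · rw [c1, c1]
    exact boundaryClass_vertex (by omega) (by omega) e
  · rw [boundaryClass_edge hj hs0 hs1, boundaryClass_edge hj' hs0 hs1,
      glue_rim_edge j hj j' hj' e e']
  · exact absurd e' (glue_rim_edge_ne j hj j' hj' e)

lemma push_wheel_arc {k : ℕ} (hk : k < 5) {t : ℝ} (h0 : 0 ≤ t) (h1 : t ≤ 1) :
    push glue (wheel 1 (6 * k + 3 * t)) = push glue (wheel 1 (6 * k + 3 + 3 * t)) := by
  obtain ⟨e, he, s, hs0, hs1, hes⟩ : ∃ e < 3, ∃ s : ℝ, 0 ≤ s ∧ s ≤ 1 ∧ 3 * t = (e : ℕ) + s := by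
    rcases h1.lt_or_eq with h | h
    · refine ⟨⌊3 * t⌋₊, ?_, 3 * t - ⌊3 * t⌋₊, sub_nonneg.2 (Nat.floor_le (by positivity)), ?_,
        by ring⟩
      · exact (Nat.floor_lt (by positivity)).2 (by push_cast; linarith)
      · linarith [Nat.lt_floor_add_one (3 * t)]
    · exact ⟨2, by norm_num, 1, zero_le_one, le_rfl, by rw [h]; norm_num⟩
  have e1 : 6 * (k : ℝ) + 3 * t = (6 * k + e : ℕ) + s := by rw [hes]; push_cast; ring
  have e2 : 6 * (k : ℝ) + 3 + 3 * t = (6 * k + e + 3 : ℕ) + s := by rw [hes]; push_cast; ring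
  rw [e1, e2, push_wheel_one (by omega) hs0 hs1, push_wheel_one (by omega) hs0 hs1,
    glue_rim_arc k hk e (by omega), show 6 * k + e + 1 = 6 * k + (e + 1) by ring,
    glue_rim_arc k hk (e + 1) (by omega), show 6 * k + (e + 1) + 3 = 6 * k + e + 3 + 1 by ring]

lemma wheel_one_supported {φ : ℝ} (v : Fin 61) (hv : wheel 1 φ v ≠ 0) :
    (2 ^ 30 - 1).testBit v = true := by
  rw [Nat.testBit_two_pow_sub_one, decide_eq_true_eq]
  by_contra hcon
  simp [wheel, hcon] at hv

/-- The surface in its polygonal normal form is homeomorphic to the quotient of the triangulated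
disc. -/
theorem nonempty_homeomorph_hub :
    Nonempty (carrier (facets 42 hubFacets) ≃ₜ NonorientableSurface 5) := by
  obtain ⟨e, he, he'⟩ := exists_homeomorph_run run_ringMoves
  let Q := Set.Icc (0 : ℝ) 1 × Set.Icc (0 : ℝ) 30
  let p : Q → Metric.closedBall (0 : ℂ) 1 := fun q => ⟨polar q.1 q.2, by
    rw [mem_closedBall_zero_iff, norm_polar q.1.2.1]
    exact q.1.2.2⟩
  have hval : Continuous fun q : Q => ((q.1 : ℝ), (q.2 : ℝ)) :=
    (continuous_subtype_val.comp continuous_fst).prodMk (continuous_subtype_val.comp continuous_snd)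
  have hp : Continuous p := (continuous_polar.comp hval).subtype_mk _
  have hps : Function.Surjective p := fun z => by
    obtain ⟨r, φ, hr, hφ, h⟩ := exists_polar_eq (mem_closedBall_zero_iff.1 z.2)
    exact ⟨(⟨r, hr⟩, ⟨φ, hφ⟩), Subtype.ext h⟩
  let w : Q → carrier (facets 61 coneFacets) := fun q =>
    ⟨wheel q.1 q.2, wheel_mem q.1.2.1 q.1.2.2 q.2.2.1 q.2.2.2⟩
  have hw : Continuous w := (continuous_wheel.comp hval).subtype_mk _
  let g : Q → carrier (facets 42 hubFacets) := fun q =>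
    ⟨push glue (e (w q)).1, by rw [facets_hubFacets]; exact push_mem_carrier (e (w q)).2⟩
  have hg : Continuous g :=
    ((continuous_push glue).comp (continuous_subtype_val.comp (e.continuous.comp hw))).subtype_mk _
  have hgs : Function.Surjective g := by
    rintro ⟨y, hy⟩
    obtain ⟨x, hx, hxy⟩ := exists_push_eq glue_injOn_facet (facets_hubFacets ▸ hy)
    obtain ⟨r, φ, hr, hφ, h⟩ := exists_wheel_eq (e.symm ⟨x, hx⟩).2
    refine ⟨(⟨r, hr⟩, ⟨φ, hφ⟩), Subtype.ext ?_⟩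
    have h1 : w (⟨r, hr⟩, ⟨φ, hφ⟩) = e.symm ⟨x, hx⟩ := Subtype.ext h
    change push glue (e (w _)).1 = y
    rw [h1, e.apply_symm_apply]
    exact hxy
  have hgone : ∀ φ : Set.Icc (0 : ℝ) 30, ∀ r : Set.Icc (0 : ℝ) 1, (r : ℝ) = 1 →
      (g (r, φ)).1 = push glue (wheel 1 φ) := fun φ r hr => by
    have h1 : (w (r, φ)).1 = wheel 1 φ := by
      change wheel r φ = _
      rw [hr]
    have h2 := he (w (r, φ)) fun v hv =>
      wheel_one_supported v (by rwa [h1] at hv)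
    change push glue (e (w (r, φ))).1 = _
    rw [h2, h1]
  have hpg : ∀ q q', p q = p q' → g q = g q' := fun q q' h => by
    have h1 : w q = w q' := Subtype.ext (wheel_eq_of_polar_eq q.1.2.1 q'.1.2.1 q.2.2.1 q.2.2.2
      q'.2.2.1 q'.2.2.2 (congrArg Subtype.val h))
    exact Subtype.ext (by change push glue (e (w q)).1 = push glue (e (w q')).1; rw [h1])
  let f : Metric.closedBall (0 : ℂ) 1 → carrier (facets 42 hubFacets) :=
    fun z => g (Function.surjInv hps z)
  have hf : ∀ q, f (p q) = g q := fun q => hpg _ _ (Function.surjInv_eq hps _)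
  have hrel : ∀ x y, crosscapRel 5 x y → f x = f y := by
    rintro x y ⟨k, t, ht, hx, hy⟩
    have hk : ((k : ℕ) : ℝ) ≤ 4 := by exact_mod_cast Nat.lt_succ_iff.1 k.2
    have ht0 := ht.1
    have ht1 := ht.2
    rw [← polar_one_first_arc] at hx
    rw [← polar_one_second_arc] at hy
    let one : Set.Icc (0 : ℝ) 1 := ⟨1, zero_le_one, le_rfl⟩
    let φ : Set.Icc (0 : ℝ) 30 := ⟨6 * (k : ℕ) + 3 * t, by positivity, by linarith⟩
    let φ' : Set.Icc (0 : ℝ) 30 := ⟨6 * (k : ℕ) + 3 + 3 * t, by positivity, by linarith⟩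
    have e1 : p (one, φ) = x := Subtype.ext hx.symm
    have e2 : p (one, φ') = y := Subtype.ext hy.symm
    rw [← e1, ← e2, hf, hf]
    apply Subtype.ext
    rw [hgone φ one rfl, hgone φ' one rfl]
    exact push_wheel_arc k.2 ht0 ht1
  have hback : ∀ q q', g q = g q' →
      (Quot.mk (crosscapRel 5) (p q)) = Quot.mk (crosscapRel 5) (p q') := by
    intro q q' h
    have h1 : push glue (e (w q)).1 = push glue (e (w q')).1 := congrArg Subtype.val h
    have hcase : ∀ u : Fin 61, 30 ≤ u.val → (e (w q)).1 u ≠ 0 ∨ (e (w q')).1 u ≠ 0 →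
        Quot.mk (crosscapRel 5) (p q) = Quot.mk (crosscapRel 5) (p q') := by
      intro u hu hne
      have h2 : (e (w q)).1 = (e (w q')).1 := by
        rcases hne with hne | hne
        · exact eq_of_push_eq (fun v => glue_eq_of_le hu) (glue_injOn_star hu) (e (w q)).2
            (e (w q')).2 h1 hne
        · exact (eq_of_push_eq (fun v => glue_eq_of_le hu) (glue_injOn_star hu) (e (w q')).2
            (e (w q)).2 h1.symm hne).symm
      have h3 : w q = w q' := e.injective (Subtype.ext h2)
      have h4 : p q = p q' := Subtype.ext (polar_eq_of_wheel_eq q.2.2.1 q.2.2.2 q'.2.2.1 q'.2.2.2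
        (congrArg Subtype.val h3))
      rw [h4]
    by_cases hex : ∃ u : Fin 61, 30 ≤ u.val ∧ ((e (w q)).1 u ≠ 0 ∨ (e (w q')).1 u ≠ 0)
    · obtain ⟨u, hu, hne⟩ := hex
      exact hcase u hu hne
    · push Not at hex
      have hone : ∀ q : Q, (∀ u : Fin 61, 30 ≤ u.val → (e (w q)).1 u = 0) →
          (q.1 : ℝ) = 1 := by
        intro q hq
        have h2 := he' (e (w q)) fun v hv => by
          rw [Nat.testBit_two_pow_sub_one, decide_eq_true_eq]
          by_contra hcon
          exact hv (hq v (not_lt.1 hcon))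
        rw [e.symm_apply_apply] at h2
        have h3 : wheel q.1 q.2 60 = 0 := by
          change (w q).1 60 = 0
          rw [h2]
          exact hq 60 (by decide)
        simp only [wheel] at h3
        norm_num at h3
        have h4 : 1 - (q.1 : ℝ) = 0 := by simpa using h3
        linarith
      obtain ⟨r, φ⟩ := q
      obtain ⟨r', φ'⟩ := q'
      have hr : (r : ℝ) = 1 := hone (r, φ) fun u hu => (hex u hu).1
      have hr' : (r' : ℝ) = 1 := hone (r', φ') fun u hu => (hex u hu).2
      have h2 : push glue (wheel 1 φ) = push glue (wheel 1 φ') := by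
        rw [← hgone φ r hr, ← hgone φ' r' hr', h]
      have h3 := boundaryClass_eq_of_push_eq φ.2.1 φ.2.2 φ'.2.1 φ'.2.2 h2
      have e1 : p (r, φ) = ⟨polar 1 φ, by rw [mem_closedBall_zero_iff, norm_polar zero_le_one]⟩ :=
        Subtype.ext (by change polar r φ = _; rw [hr])
      have e2 : p (r', φ') =
          ⟨polar 1 φ', by rw [mem_closedBall_zero_iff, norm_polar zero_le_one]⟩ :=
        Subtype.ext (by change polar r' φ' = _; rw [hr'])
      rw [e1, e2]
      exact h3
  have hquot : Topology.IsQuotientMap p := .of_surjective_continuous hps hp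
  have hfc : Continuous f := hquot.continuous_iff.2 (by
    have : f ∘ p = g := funext hf
    rwa [this])
  let F : Quot (crosscapRel 5) → carrier (facets 42 hubFacets) := Quot.lift f hrel
  have hF : Continuous F := continuous_quot_lift hrel hfc
  have hbij : Function.Bijective F := by
    constructor
    · rintro ⟨x⟩ ⟨y⟩ hxy
      obtain ⟨q, rfl⟩ := hps x
      obtain ⟨q', rfl⟩ := hps y
      exact hback q q' (by rw [← hf, ← hf]; exact hxy)
    · intro y
      obtain ⟨q, rfl⟩ := hgs y
      exact ⟨Quot.mk _ (p q), hf q⟩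
  have : CompactSpace (Metric.closedBall (0 : ℂ) 1) :=
    isCompact_iff_compactSpace.1 (isCompact_closedBall 0 1)
  exact ⟨(hF.homeoOfEquivCompactToT2 (f := Equiv.ofBijective F hbij)).symm⟩

/-! ### Ten triangulated surfaces -/

/-- The bit mask of a triangle. -/
def triangleMask (a b c : ℕ) : ℕ := 2 ^ a ||| 2 ^ b ||| 2 ^ c

lemma bits_triangleMask {n : ℕ} (a b c : Fin n) : bits n (triangleMask a b c) = {a, b, c} := by
  ext v
  simp [triangleMask, Nat.testBit_or, Nat.testBit_two_pow, Fin.ext_iff, eq_comm (a := v.val),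
    or_assoc]

/-- The automorphism of order three of all the triangulations. -/
def rotation (v : Fin 10) : Fin 10 := ![0, 2, 3, 1, 5, 6, 4, 8, 9, 7] v

/-- Bistellar moves that reduce the quotient of the disc to ten vertices, in eight portions, with
the triangles that result from each portion. -/
def reductions : Fin 8 → List (List ℕ × List ℕ) × List (ℕ × ℕ × ℕ) := ![
  ([
    ([0, 26], [5, 25]), ([26, 27], [5, 41]), ([26], [5, 25, 41]), ([0, 20], [3, 19]),
    ([11, 40], [10, 41]), ([40], [10, 39, 41]), ([27, 41], [5, 28]), ([27], [5, 6, 28]),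
    ([39, 41], [10, 38]), ([39], [9, 10, 38]), ([35, 41], [34, 36]), ([33, 41], [32, 34]),
    ([0, 29], [7, 28]), ([3, 20], [19, 21])],
   [
    (0, 1, 11), (0, 1, 14), (0, 2, 13), (0, 2, 16), (0, 3, 17), (0, 3, 19), (0, 4, 19),
    (0, 4, 22), (0, 5, 23), (0, 5, 25), (0, 6, 25), (0, 6, 28), (0, 7, 28), (0, 7, 32),
    (0, 8, 31), (0, 8, 34), (0, 9, 35), (0, 9, 38), (0, 10, 11), (0, 10, 37), (0, 13, 14),
    (0, 16, 17), (0, 22, 23), (0, 31, 32), (0, 34, 35), (0, 37, 38), (1, 2, 12), (1, 2, 15),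
    (1, 11, 12), (1, 14, 15), (2, 12, 13), (2, 15, 16), (3, 4, 18), (3, 4, 21), (3, 17, 18),
    (3, 19, 21), (4, 18, 19), (4, 21, 22), (5, 6, 24), (5, 6, 28), (5, 23, 24), (5, 25, 41),
    (5, 28, 41), (6, 24, 25), (7, 8, 30), (7, 8, 33), (7, 28, 29), (7, 29, 30), (7, 32, 33),
    (8, 30, 31), (8, 33, 34), (9, 10, 36), (9, 10, 38), (9, 35, 36), (10, 11, 41), (10, 36, 37),
    (10, 38, 41), (11, 12, 41), (12, 13, 41), (13, 14, 41), (14, 15, 41), (15, 16, 41),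
    (16, 17, 41), (17, 18, 41), (18, 19, 41), (19, 20, 21), (19, 20, 41), (20, 21, 41),
    (21, 22, 41), (22, 23, 41), (23, 24, 41), (24, 25, 41), (28, 29, 41), (29, 30, 41),
    (30, 31, 41), (31, 32, 41), (32, 33, 34), (32, 34, 41), (34, 35, 36), (34, 36, 41),
    (36, 37, 41), (37, 38, 41)]),
  ([
    ([20], [19, 21, 41]), ([8, 33], [7, 34]), ([33], [7, 32, 34]), ([0, 35], [9, 34]),
    ([35], [9, 34, 36]), ([29, 30], [7, 41]), ([29], [7, 28, 41]), ([30, 41], [7, 31]),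
    ([30], [7, 8, 31]), ([13, 14], [0, 41]), ([0, 11], [1, 10]), ([1, 14], [0, 15]),
    ([14], [0, 15, 41]), ([0, 22], [4, 23])],
   [
    (0, 1, 10), (0, 1, 15), (0, 2, 13), (0, 2, 16), (0, 3, 17), (0, 3, 19), (0, 4, 19),
    (0, 4, 23), (0, 5, 23), (0, 5, 25), (0, 6, 25), (0, 6, 28), (0, 7, 28), (0, 7, 32),
    (0, 8, 31), (0, 8, 34), (0, 9, 34), (0, 9, 38), (0, 10, 37), (0, 13, 41), (0, 15, 41),
    (0, 16, 17), (0, 31, 32), (0, 37, 38), (1, 2, 12), (1, 2, 15), (1, 10, 11), (1, 11, 12),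
    (2, 12, 13), (2, 15, 16), (3, 4, 18), (3, 4, 21), (3, 17, 18), (3, 19, 21), (4, 18, 19),
    (4, 21, 22), (4, 22, 23), (5, 6, 24), (5, 6, 28), (5, 23, 24), (5, 25, 41), (5, 28, 41),
    (6, 24, 25), (7, 8, 31), (7, 8, 34), (7, 28, 41), (7, 31, 41), (7, 32, 34), (9, 10, 36),
    (9, 10, 38), (9, 34, 36), (10, 11, 41), (10, 36, 37), (10, 38, 41), (11, 12, 41),
    (12, 13, 41), (15, 16, 41), (16, 17, 41), (17, 18, 41), (18, 19, 41), (19, 21, 41),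
    (21, 22, 41), (22, 23, 41), (23, 24, 41), (24, 25, 41), (31, 32, 41), (32, 34, 41),
    (34, 36, 41), (36, 37, 41), (37, 38, 41)]),
  ([
    ([0, 16], [2, 17]), ([22, 23], [4, 41]), ([22], [4, 21, 41]), ([19, 21], [3, 41]),
    ([21], [3, 4, 41]), ([12, 13], [2, 41]), ([13], [0, 2, 41]), ([0, 8], [31, 34]),
    ([8], [7, 31, 34]), ([16, 41], [15, 17]), ([16], [2, 15, 17]), ([1, 11], [10, 12]),
    ([11], [10, 12, 41]), ([2, 12], [1, 41])],
   [
    (0, 1, 10), (0, 1, 15), (0, 2, 17), (0, 2, 41), (0, 3, 17), (0, 3, 19), (0, 4, 19),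
    (0, 4, 23), (0, 5, 23), (0, 5, 25), (0, 6, 25), (0, 6, 28), (0, 7, 28), (0, 7, 32),
    (0, 9, 34), (0, 9, 38), (0, 10, 37), (0, 15, 41), (0, 31, 32), (0, 31, 34), (0, 37, 38),
    (1, 2, 15), (1, 2, 41), (1, 10, 12), (1, 12, 41), (2, 15, 17), (3, 4, 18), (3, 4, 41),
    (3, 17, 18), (3, 19, 41), (4, 18, 19), (4, 23, 41), (5, 6, 24), (5, 6, 28), (5, 23, 24),
    (5, 25, 41), (5, 28, 41), (6, 24, 25), (7, 28, 41), (7, 31, 34), (7, 31, 41), (7, 32, 34),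
    (9, 10, 36), (9, 10, 38), (9, 34, 36), (10, 12, 41), (10, 36, 37), (10, 38, 41),
    (15, 17, 41), (17, 18, 41), (18, 19, 41), (23, 24, 41), (24, 25, 41), (31, 32, 41),
    (32, 34, 41), (34, 36, 41), (36, 37, 41), (37, 38, 41)]),
  ([
    ([12], [1, 10, 41]), ([36, 41], [34, 37]), ([36, 37], [10, 34]), ([36], [9, 10, 34]),
    ([9, 10], [34, 38]), ([9], [0, 34, 38]), ([0, 17], [2, 3]), ([28, 41], [5, 7]),
    ([0, 1], [10, 15]), ([4, 19], [0, 18]), ([1, 41], [2, 10]), ([1], [2, 10, 15]),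
    ([5, 28], [6, 7]), ([28], [0, 6, 7]), ([4, 41], [3, 23])],
   [
    (0, 2, 3), (0, 2, 41), (0, 3, 19), (0, 4, 18), (0, 4, 23), (0, 5, 23), (0, 5, 25), (0, 6, 7),
    (0, 6, 25), (0, 7, 32), (0, 10, 15), (0, 10, 37), (0, 15, 41), (0, 18, 19), (0, 31, 32),
    (0, 31, 34), (0, 34, 38), (0, 37, 38), (2, 3, 17), (2, 10, 15), (2, 10, 41), (2, 15, 17),
    (3, 4, 18), (3, 4, 23), (3, 17, 18), (3, 19, 41), (3, 23, 41), (5, 6, 7), (5, 6, 24),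
    (5, 7, 41), (5, 23, 24), (5, 25, 41), (6, 24, 25), (7, 31, 34), (7, 31, 41), (7, 32, 34),
    (10, 34, 37), (10, 34, 38), (10, 38, 41), (15, 17, 41), (17, 18, 41), (18, 19, 41),
    (23, 24, 41), (24, 25, 41), (31, 32, 41), (32, 34, 41), (34, 37, 41), (37, 38, 41)]),
  ([
    ([3, 4], [18, 23]), ([4], [0, 18, 23]), ([2, 17], [3, 15]), ([17, 41], [15, 18]),
    ([17], [3, 15, 18]), ([7, 41], [5, 31]), ([5, 23], [0, 24]), ([24, 25], [6, 41]),
    ([0, 6], [7, 25]), ([0, 3], [2, 19]), ([6, 25], [7, 41]), ([18, 41], [15, 19]),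
    ([5, 6], [7, 24]), ([6], [7, 24, 41])],
   [
    (0, 2, 19), (0, 2, 41), (0, 5, 24), (0, 5, 25), (0, 7, 25), (0, 7, 32), (0, 10, 15),
    (0, 10, 37), (0, 15, 41), (0, 18, 19), (0, 18, 23), (0, 23, 24), (0, 31, 32), (0, 31, 34),
    (0, 34, 38), (0, 37, 38), (2, 3, 15), (2, 3, 19), (2, 10, 15), (2, 10, 41), (3, 15, 18),
    (3, 18, 23), (3, 19, 41), (3, 23, 41), (5, 7, 24), (5, 7, 31), (5, 25, 41), (5, 31, 41),
    (7, 24, 41), (7, 25, 41), (7, 31, 34), (7, 32, 34), (10, 34, 37), (10, 34, 38), (10, 38, 41),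
    (15, 18, 19), (15, 19, 41), (23, 24, 41), (31, 32, 41), (32, 34, 41), (34, 37, 41),
    (37, 38, 41)]),
  ([
    ([18, 23], [0, 3]), ([0, 23], [3, 24]), ([23], [3, 24, 41]), ([0, 10], [15, 37]),
    ([10, 37], [15, 34]), ([0, 19], [2, 18]), ([5, 41], [25, 31]), ([25, 31], [5, 41]),
    ([0, 24], [3, 5]), ([5, 24], [3, 7]), ([24], [3, 7, 41]), ([10, 41], [2, 38]),
    ([2, 10], [15, 38]), ([10], [15, 34, 38])],
   [
    (0, 2, 18), (0, 2, 41), (0, 3, 5), (0, 3, 18), (0, 5, 25), (0, 7, 25), (0, 7, 32),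
    (0, 15, 37), (0, 15, 41), (0, 31, 32), (0, 31, 34), (0, 34, 38), (0, 37, 38), (2, 3, 15),
    (2, 3, 19), (2, 15, 38), (2, 18, 19), (2, 38, 41), (3, 5, 7), (3, 7, 41), (3, 15, 18),
    (3, 19, 41), (5, 7, 31), (5, 25, 41), (5, 31, 41), (7, 25, 41), (7, 31, 34), (7, 32, 34),
    (15, 18, 19), (15, 19, 41), (15, 34, 37), (15, 34, 38), (31, 32, 41), (32, 34, 41),
    (34, 37, 41), (37, 38, 41)]),
  ([
    ([7, 41], [3, 25]), ([2, 18], [0, 19]), ([0, 3], [5, 18]), ([3, 25], [7, 41]),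
    ([34, 41], [32, 37]), ([0, 5], [18, 25]), ([0, 25], [7, 18]), ([7, 25], [18, 41]),
    ([25], [5, 18, 41]), ([5, 41], [18, 31]), ([5, 18], [3, 31]), ([5], [3, 7, 31]),
    ([15, 38], [2, 34]), ([38, 41], [2, 37])],
   [
    (0, 2, 19), (0, 2, 41), (0, 7, 18), (0, 7, 32), (0, 15, 37), (0, 15, 41), (0, 18, 19),
    (0, 31, 32), (0, 31, 34), (0, 34, 38), (0, 37, 38), (2, 3, 15), (2, 3, 19), (2, 15, 34),
    (2, 34, 38), (2, 37, 38), (2, 37, 41), (3, 7, 31), (3, 7, 41), (3, 15, 18), (3, 18, 31),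
    (3, 19, 41), (7, 18, 41), (7, 31, 34), (7, 32, 34), (15, 18, 19), (15, 19, 41), (15, 34, 37),
    (18, 31, 41), (31, 32, 41), (32, 34, 37), (32, 37, 41)]),
  ([
    ([34, 37], [15, 32]), ([2, 38], [34, 37]), ([38], [0, 34, 37]), ([37, 41], [2, 32]),
    ([3, 41], [7, 19]), ([3, 15], [2, 18]), ([3, 7], [19, 31]), ([3, 19], [2, 31]),
    ([3], [2, 18, 31]), ([0, 34], [31, 37]), ([2, 18], [15, 31]), ([32, 34], [7, 15]),
    ([15, 34], [2, 7]), ([2, 34], [7, 37]), ([34], [7, 31, 37])],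
   [
    (0, 2, 19), (0, 2, 41), (0, 7, 18), (0, 7, 32), (0, 15, 37), (0, 15, 41), (0, 18, 19),
    (0, 31, 32), (0, 31, 37), (2, 7, 15), (2, 7, 37), (2, 15, 31), (2, 19, 31), (2, 32, 37),
    (2, 32, 41), (7, 15, 32), (7, 18, 41), (7, 19, 31), (7, 19, 41), (7, 31, 37), (15, 18, 19),
    (15, 18, 31), (15, 19, 41), (15, 32, 37), (18, 31, 41), (31, 32, 41)])]

/-- A triangulated surface with vertices `0, …, 9` that is invariant under `rotation`, with
coordinates of the vertices `0` (on the axis) and `1`, `4`, `7`, and with flips that lead to it from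
the final complex of `reductions`, the vertices being relabelled by `labels`. -/
structure SymmetricSurface where
  /-- Representatives of the orbits of triangles other than `123` and `456`. -/
  representatives : List (Fin 10 × Fin 10 × Fin 10)
  /-- The coordinates of the vertex `0` are all equal to this integer. -/
  apex : ℤ
  /-- The coordinates of the vertices `1`, `4`, `7`. -/
  base : Fin 3 → ℤ × ℤ × ℤ
  /-- The relabelling of the vertices. -/
  labels : Fin 10 → Fin 42
  /-- A flip `(a, b, c, d)` replaces the edge `ab` by the edge `cd`. -/
  flips : List (ℕ × ℕ × ℕ × ℕ)

/-- The ten triangulations with their realizations. -/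
def surfaces : Fin 10 → SymmetricSurface := ![
  { representatives := [
      (1, 2, 4), (0, 1, 4), (0, 1, 7), (0, 4, 8), (1, 5, 6), (1, 5, 8), (1, 7, 8), (4, 7, 8)]
    apex := -5
    base := ![(-1, -3, 13), (1, -2, -2), (2, -1, 3)]
    labels := ![15, 32, 31, 41, 7, 18, 0, 37, 2, 19]
    flips := [
      (0, 19, 2, 18), (7, 31, 19, 37), (0, 32, 7, 31), (2, 41, 0, 32), (0, 2, 18, 32),
      (7, 19, 37, 41), (31, 37, 0, 19)] },
  { representatives := [
      (1, 2, 4), (0, 1, 4), (0, 1, 7), (0, 4, 8), (1, 6, 8), (1, 5, 7), (1, 5, 8), (4, 5, 8)]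
    apex := -3
    base := ![(9, 1, 0), (3, 2, -2), (5, 1, 1)]
    labels := ![15, 32, 31, 41, 7, 18, 0, 37, 2, 19]
    flips := [
      (7, 31, 19, 37), (0, 32, 7, 31), (2, 41, 0, 32), (7, 19, 37, 41), (7, 41, 18, 37),
      (7, 37, 2, 18), (0, 31, 7, 37), (2, 19, 0, 31), (2, 37, 18, 32), (31, 37, 7, 19),
      (19, 37, 7, 41)] },
  { representatives := [
      (1, 2, 4), (0, 1, 4), (0, 1, 7), (0, 4, 8), (1, 6, 8), (1, 7, 8), (4, 5, 8), (4, 7, 9)]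
    apex := 3
    base := ![(-4, 3, -9), (-3, 0, 1), (-5, -1, -3)]
    labels := ![15, 32, 31, 41, 7, 18, 0, 37, 2, 19]
    flips := [
      (7, 31, 19, 37), (0, 32, 7, 31), (2, 41, 0, 32), (7, 19, 37, 41), (7, 41, 18, 37),
      (7, 37, 2, 18), (0, 31, 7, 37), (31, 37, 7, 19)] },
  { representatives := [
      (1, 2, 4), (0, 1, 4), (0, 1, 7), (0, 4, 8), (1, 6, 9), (1, 5, 7), (1, 5, 9), (4, 5, 7)]
    apex := 1
    base := ![(0, -4, 3), (8, 1, 3), (2, 4, 2)]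
    labels := ![0, 19, 7, 15, 18, 31, 41, 2, 32, 37]
    flips := [
      (7, 31, 19, 37), (0, 32, 7, 31), (7, 19, 37, 41), (7, 41, 18, 37), (15, 31, 2, 18),
      (7, 32, 15, 31), (2, 37, 7, 32), (2, 32, 7, 41), (7, 37, 18, 32), (7, 18, 0, 32),
      (2, 15, 7, 18), (15, 18, 7, 19), (32, 37, 15, 18)] },
  { representatives := [
      (1, 2, 4), (1, 4, 7), (1, 6, 8), (0, 1, 7), (0, 1, 5), (0, 4, 8), (1, 5, 8), (4, 5, 9)]
    apex := 6
    base := ![(-1, -2, 0), (-3, -3, 2), (4, 2, -5)]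
    labels := ![15, 32, 41, 31, 18, 7, 0, 37, 19, 2]
    flips := [
      (7, 31, 19, 37), (0, 32, 7, 31), (7, 19, 37, 41), (7, 41, 18, 37), (7, 37, 2, 18),
      (0, 31, 7, 37), (2, 19, 0, 31), (2, 37, 18, 32), (31, 37, 7, 19), (7, 31, 19, 32),
      (18, 41, 31, 37), (2, 32, 18, 41), (19, 31, 0, 32), (19, 37, 7, 41), (37, 41, 7, 31)] },
  { representatives := [
      (1, 2, 4), (1, 4, 7), (1, 6, 8), (0, 1, 7), (0, 1, 9), (1, 8, 9), (4, 5, 8), (4, 8, 9)]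
    apex := 2
    base := ![(-3, 2, 11), (3, -5, -3), (0, -2, 1)]
    labels := ![0, 19, 15, 37, 18, 32, 41, 7, 31, 2]
    flips := [
      (0, 15, 37, 41), (7, 32, 0, 15), (2, 37, 7, 32), (0, 41, 2, 37), (15, 31, 2, 18),
      (0, 32, 15, 31), (15, 41, 19, 37), (31, 41, 18, 32), (7, 19, 31, 41), (0, 18, 7, 19)] },
  { representatives := [
      (1, 2, 7), (0, 1, 7), (0, 1, 4), (0, 4, 9), (1, 4, 8), (1, 5, 8), (1, 5, 9), (4, 5, 7)]
    apex := -10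
    base := ![(5, -3, 2), (0, -1, -3), (2, 4, -6)]
    labels := ![15, 0, 19, 32, 37, 41, 31, 2, 18, 7]
    flips := [
      (0, 7, 18, 32), (0, 18, 19, 32), (2, 32, 37, 41), (7, 15, 2, 32), (7, 32, 2, 18),
      (2, 7, 18, 37), (31, 37, 0, 7), (0, 31, 7, 32), (7, 37, 0, 18), (32, 41, 31, 37),
      (31, 32, 7, 37), (2, 15, 31, 32), (0, 41, 2, 15), (7, 18, 0, 41), (32, 37, 7, 15),
      (2, 18, 32, 37)] },
  { representatives := [
      (1, 2, 7), (0, 1, 7), (0, 1, 4), (0, 4, 9), (1, 4, 8), (1, 6, 8), (1, 6, 9), (4, 5, 8)]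
    apex := -5
    base := ![(-3, -15, 1), (-3, 4, -1), (6, -2, -3)]
    labels := ![15, 0, 7, 18, 41, 32, 31, 37, 2, 19]
    flips := [
      (7, 31, 19, 37), (0, 32, 7, 31), (7, 19, 37, 41), (7, 41, 18, 37), (7, 37, 2, 18),
      (0, 31, 7, 37), (2, 19, 0, 31), (2, 37, 18, 32), (31, 37, 7, 19), (7, 31, 19, 32),
      (18, 41, 31, 37), (19, 37, 7, 41)] },
  { representatives := [
      (1, 2, 7), (0, 1, 7), (0, 1, 4), (0, 4, 9), (1, 4, 8), (1, 8, 9), (4, 5, 7), (4, 7, 8)]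
    apex := -2
    base := ![(1, -3, 4), (0, -1, 0), (3, -2, 0)]
    labels := ![15, 32, 18, 41, 0, 7, 19, 31, 37, 2]
    flips := [
      (15, 31, 2, 18), (31, 41, 18, 32), (7, 19, 31, 41), (0, 18, 7, 19), (7, 31, 37, 41),
      (0, 32, 7, 31), (7, 32, 15, 31), (7, 41, 18, 37), (7, 18, 19, 37), (2, 15, 7, 18),
      (0, 41, 2, 15), (15, 37, 0, 32), (18, 19, 15, 37)] },
  { representatives := [
      (1, 2, 7), (1, 4, 7), (0, 1, 4), (0, 1, 6), (1, 6, 8), (1, 8, 9), (4, 5, 8), (4, 8, 9)]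
    apex := -3
    base := ![(6, -2, -1), (-3, 17, -2), (3, 3, 1)]
    labels := ![15, 32, 18, 41, 7, 19, 0, 31, 37, 2]
    flips := [
      (15, 31, 2, 18), (31, 41, 18, 32), (7, 19, 31, 41), (0, 18, 7, 19), (7, 31, 37, 41),
      (0, 32, 7, 31), (7, 41, 18, 37), (7, 18, 19, 37), (2, 15, 7, 18), (15, 37, 0, 32)] }]

/-- The triangles of a symmetric surface. -/
def SymmetricSurface.triangles (S : SymmetricSurface) : List (Fin 10 × Fin 10 × Fin 10) :=
  (1, 2, 3) :: (4, 5, 6) :: S.representatives.flatMap fun t =>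
    [t, (rotation t.1, rotation t.2.1, rotation t.2.2),
      (rotation (rotation t.1), rotation (rotation t.2.1), rotation (rotation t.2.2))]

/-- The bit masks of the triangles of a symmetric surface. -/
def SymmetricSurface.masks (S : SymmetricSurface) : List ℕ :=
  S.triangles.map fun t => triangleMask t.1 t.2.1 t.2.2

/-- The bit masks of the relabelled triangles of a symmetric surface. -/
def SymmetricSurface.labelledMasks (S : SymmetricSurface) : List ℕ :=
  S.triangles.map fun t => triangleMask (S.labels t.1) (S.labels t.2.1) (S.labels t.2.2)

/-- The bit mask of a list of vertices. -/
def listMask (l : List ℕ) : ℕ := l.foldr (fun v a => 2 ^ v ||| a) 0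

/-- The two lists have the same elements. -/
def sameElements (L L' : List ℕ) : Bool := L.all (L'.contains ·) && L'.all (L.contains ·)

lemma facets_eq_of_sameElements {n : ℕ} {L L' : List ℕ} (h : sameElements L L' = true) :
    facets n L = facets n L' := by
  simp only [sameElements, Bool.and_eq_true, List.all_eq_true, List.contains_iff_mem] at h
  ext t
  exact ⟨fun ⟨m, hm, e⟩ => ⟨m, h.1 m hm, e⟩, fun ⟨m, hm, e⟩ => ⟨m, h.2 m hm, e⟩⟩

/-- The moves are possible and transform the first complex into the second one. -/
def runsTo (n : ℕ) (M : List (ℕ × ℕ)) (L L' : List ℕ) : Bool :=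
  evalList L' fun L' => (evalList L (run n 0 M)).any fun K => sameElements K L'

lemma nonempty_homeomorph_of_runsTo {n : ℕ} {M : List (ℕ × ℕ)} {L L' : List ℕ}
    (h : runsTo n M L L' = true) :
    Nonempty (carrier (facets n L) ≃ₜ carrier (facets n L')) := by
  rw [runsTo, evalList_eq, evalList_eq] at h
  obtain ⟨K, hK, hL'⟩ := (Option.any_eq_true _ _).1 h
  obtain ⟨e, -⟩ := exists_homeomorph_run hK
  rw [← facets_eq_of_sameElements hL']
  exact ⟨e⟩

/-- The complexes that result from the reductions, encoded by bit masks. -/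
def reducedMasks : ℕ → List ℕ
  | 0 => hubFacets
  | k + 1 => (reductions (Fin.ofNat 8 k)).2.map fun t => triangleMask t.1 t.2.1 t.2.2

/-- The flips of a symmetric surface, encoded by bit masks. -/
def SymmetricSurface.flipMasks (S : SymmetricSurface) : List (ℕ × ℕ) :=
  S.flips.map fun m => (2 ^ m.1 ||| 2 ^ m.2.1, 2 ^ m.2.2.1 ||| 2 ^ m.2.2.2)

set_option maxHeartbeats 4000000 in
lemma runsTo_reducedMasks : ∀ k : Fin 8,
    runsTo 42 ((reductions k).1.map fun m => (listMask m.1, listMask m.2)) (reducedMasks k)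
      (reducedMasks (k + 1)) = true := by
  decide +kernel

lemma nonempty_homeomorph_reducedMasks {k : ℕ} (hk : k ≤ 8) :
    Nonempty (carrier (facets 42 hubFacets) ≃ₜ carrier (facets 42 (reducedMasks k))) := by
  induction k with
  | zero => exact ⟨Homeomorph.refl _⟩
  | succ k ih =>
    obtain ⟨e⟩ := ih (by omega)
    obtain ⟨f⟩ := nonempty_homeomorph_of_runsTo (runsTo_reducedMasks ⟨k, by omega⟩)
    exact ⟨e.trans f⟩

set_option maxHeartbeats 4000000 in
lemma runsTo_labelledMasks : ∀ i,
    runsTo 42 (surfaces i).flipMasks (reducedMasks 8) (surfaces i).labelledMasks = true := by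
  decide +kernel

lemma labels_injective : ∀ i, Function.Injective (surfaces i).labels := by
  decide +kernel

/-- The underlying spaces of the ten triangulations are homeomorphic to the surface. -/
theorem nonempty_homeomorph_surface (i : Fin 10) :
    Nonempty (carrier (facets 10 (surfaces i).masks) ≃ₜ NonorientableSurface 5) := by
  obtain ⟨e₁⟩ := nonempty_homeomorph_reducedMasks le_rfl
  obtain ⟨e₂⟩ := nonempty_homeomorph_of_runsTo (runsTo_labelledMasks i)
  obtain ⟨e₃⟩ := nonempty_homeomorph_hub
  have h : ∀ t ∈ (surfaces i).triangles,
      (bits 10 (triangleMask t.1 t.2.1 t.2.2)).map ⟨(surfaces i).labels, labels_injective i⟩ =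
        bits 42 (triangleMask ((surfaces i).labels t.1) ((surfaces i).labels t.2.1)
          ((surfaces i).labels t.2.2)) := fun t _ => by
    rw [bits_triangleMask, bits_triangleMask]
    simp
  refine ⟨((carrierMapHomeomorph ⟨(surfaces i).labels, labels_injective i⟩ _ _ ?_ ?_).trans
    (e₁.trans e₂).symm).trans e₃⟩
  · rintro _ ⟨m, hm, rfl⟩
    obtain ⟨t, ht, rfl⟩ := List.mem_map.1 hm
    exact ⟨_, ⟨_, List.mem_map.2 ⟨t, ht, rfl⟩, rfl⟩, (h t ht).le⟩
  · rintro _ ⟨m, hm, rfl⟩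
    obtain ⟨t, ht, rfl⟩ := List.mem_map.1 hm
    exact ⟨_, ⟨_, List.mem_map.2 ⟨t, ht, rfl⟩, rfl⟩, (h t ht).ge⟩

/-! ### Simplicial complexes generated by facets -/

section Facets

variable {V : Type*}

/-- The simplicial complex generated by a family of facets that cover the vertices. -/
def ofFacets (F : Set (Finset V)) (h : ∀ v, ∃ t ∈ F, v ∈ t) : AbstractSimplicialComplex V where
  faces := {s | s.Nonempty ∧ ∃ t ∈ F, s ⊆ t}
  isRelLowerSet_faces := fun {_} ⟨hs, t, ht, hst⟩ =>
    ⟨hs, fun _ hus hu => ⟨hu, t, ht, hus.trans hst⟩⟩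
  singleton_mem v := by
    obtain ⟨t, ht, hv⟩ := h v
    exact ⟨singleton_nonempty v, t, ht, singleton_subset_iff.2 hv⟩

lemma mem_faces_ofFacets {F : Set (Finset V)} {h : ∀ v, ∃ t ∈ F, v ∈ t} {s : Finset V} :
    s ∈ (ofFacets F h).faces ↔ s.Nonempty ∧ ∃ t ∈ F, s ⊆ t := Iff.rfl

lemma space_ofFacets [Fintype V] (F : Set (Finset V)) (h : ∀ v, ∃ t ∈ F, v ∈ t) :
    space (ofFacets F h) = carrier F := by
  classical
  ext x
  constructor
  · rintro ⟨h0, h1, s, ⟨-, t, ht, hst⟩, hs⟩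
    exact ⟨h0, h1, t, ht, fun v hv => hst ((hs v).2 hv)⟩
  · rintro ⟨h0, h1, t, ht, hs⟩
    refine ⟨h0, h1, univ.filter fun v => x v ≠ 0, ⟨?_, t, ht, fun v hv => ?_⟩, fun v => by simp⟩
    · obtain ⟨v, -, hv⟩ := exists_ne_zero_of_sum_ne_zero (h1.trans_ne one_ne_zero)
      exact ⟨v, by simpa using hv⟩
    · exact hs v (by simpa using hv)

lemma isIso_ofFacets {F : Set (Finset V)} {h : ∀ v, ∃ t ∈ F, v ∈ t} {σ : V ≃ V}
    (hσ : ∀ v, σ (σ (σ v)) = v) (hF : ∀ t ∈ F, t.map σ.toEmbedding ∈ F) :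
    IsIso (ofFacets F h) (ofFacets F h) σ := by
  have h1 : ∀ s ∈ (ofFacets F h).faces, s.map σ.toEmbedding ∈ (ofFacets F h).faces := by
    rintro s ⟨hs, t, ht, hst⟩
    exact ⟨hs.map, _, hF t ht, map_subset_map.2 hst⟩
  intro s
  refine ⟨h1 s, fun hs => ?_⟩
  have h2 := h1 _ (h1 _ hs)
  rw [map_map, map_map] at h2
  have h3 : s.map ((σ.toEmbedding.trans σ.toEmbedding).trans σ.toEmbedding) = s := by
    ext v
    simp [hσ]
  exact h3 ▸ h2

end Facets

/-! ### Symmetry -/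

lemma isGeometricSymmetry_of_linear {V : Type*} [Fintype V] {Δ : AbstractSimplicialComplex V}
    {ψ : V → E3} {R : E3 ≃ₗᵢ[ℝ] E3} {σ : V ≃ V} (hσ : IsIso Δ Δ σ) (hR : ∀ v, R (ψ v) = ψ (σ v)) :
    IsGeometricSymmetry Δ ψ R.toAffineIsometryEquiv := by
  refine ⟨?_, σ, hσ, hR⟩
  have key : ∀ x : V → ℝ, R (∑ v, x v • ψ v) = ∑ v, x (σ.symm v) • ψ v := fun x => by
    rw [map_sum, ← Equiv.sum_comp σ fun v => x (σ.symm v) • ψ v]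
    simp [hR]
  have hmem : ∀ x ∈ space Δ, (fun v => x (σ v)) ∈ space Δ := by
    rintro x ⟨h0, h1, s, hs, hsx⟩
    refine ⟨fun v => h0 _, (Equiv.sum_comp σ x).trans h1, s.map σ.symm.toEmbedding, ?_, fun v => ?_⟩
    · rw [hσ, map_map]
      have : s.map (σ.symm.toEmbedding.trans σ.toEmbedding) = s := by
        ext v
        simp
      rwa [this]
    · rw [← hsx]
      simp
  have hmem' : ∀ x ∈ space Δ, (fun v => x (σ.symm v)) ∈ space Δ := by
    rintro x ⟨h0, h1, s, hs, hsx⟩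
    refine ⟨fun v => h0 _, (Equiv.sum_comp σ.symm x).trans h1, s.map σ.toEmbedding, (hσ s).1 hs,
      fun v => ?_⟩
    rw [← hsx]
    simp
  ext y
  constructor
  · rintro ⟨_, ⟨x, rfl⟩, rfl⟩
    exact ⟨⟨_, hmem' x x.2⟩, (key x).symm⟩
  · rintro ⟨x, rfl⟩
    refine ⟨_, ⟨⟨_, hmem x x.2⟩, rfl⟩, ?_⟩
    refine (key _).trans ?_
    simp [simplexwiseLinear]

/-- The rotation of space that permutes the coordinates cyclically. -/
noncomputable def cyclicIsometry : E3 ≃ₗᵢ[ℝ] E3 :=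
  LinearIsometryEquiv.piLpCongrLeft 2 ℝ ℝ (finRotate 3)

lemma cyclicIsometry_apply (x : E3) (k : Fin 3) :
    cyclicIsometry x k = x ((finRotate 3).symm k) := rfl

lemma cyclicIsometry_cubed (x : E3) : cyclicIsometry (cyclicIsometry (cyclicIsometry x)) = x := by
  have h : ∀ k : Fin 3, (finRotate 3).symm ((finRotate 3).symm ((finRotate 3).symm k)) = k := by
    decide
  ext k
  rw [cyclicIsometry_apply, cyclicIsometry_apply, cyclicIsometry_apply, h]

lemma isThreefoldRotation_cyclicIsometry :
    IsThreefoldRotation cyclicIsometry.toAffineIsometryEquiv := by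
  constructor
  · have h : LinearMap.det (cyclicIsometry.toLinearEquiv : E3 →ₗ[ℝ] E3) ^ 3 = 1 := by
      rw [← map_pow, ← map_one (LinearMap.det : (E3 →ₗ[ℝ] E3) →* ℝ)]
      congr 1
      exact LinearMap.ext cyclicIsometry_cubed
    exact (Odd.strictMono_pow (by decide : Odd 3)).injective (h.trans (one_pow 3).symm)
  · refine orderOf_eq_prime (AffineIsometryEquiv.ext cyclicIsometry_cubed) fun h => ?_
    have h1 : cyclicIsometry (EuclideanSpace.single 0 1) 1 =
        (EuclideanSpace.single 0 1 : E3) 1 :=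
      congrArg (fun R : E3 ≃ᵃⁱ[ℝ] E3 => R (EuclideanSpace.single 0 1) 1) h
    rw [cyclicIsometry_apply, show (finRotate 3).symm 1 = 0 by decide] at h1
    simp at h1

/-! ### Immersions -/

/-- The difference of two integer vectors. -/
def vecSub (p q : ℤ × ℤ × ℤ) : ℤ × ℤ × ℤ := (p.1 - q.1, p.2.1 - q.2.1, p.2.2 - q.2.2)

/-- The determinant of three integer vectors. -/
def vecDet (p q r : ℤ × ℤ × ℤ) : ℤ :=
  p.1 * (q.2.1 * r.2.2 - q.2.2 * r.2.1) - p.2.1 * (q.1 * r.2.2 - q.2.2 * r.1) +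
    p.2.2 * (q.1 * r.2.1 - q.2.1 * r.1)

/-- The vectors are linearly independent. -/
def vecIndep (p q : ℤ × ℤ × ℤ) : Bool :=
  p.1 * q.2.1 - p.2.1 * q.1 != 0 || p.1 * q.2.2 - p.2.2 * q.1 != 0 ||
    p.2.1 * q.2.2 - p.2.2 * q.2.1 != 0

/-- The coefficients of the linear relation between four vectors do not all have the same sign, so
that the cones spanned by the first two and by the last two vectors meet only in the origin. -/
def conesMeetTrivially (p q r s : ℤ × ℤ × ℤ) : Bool :=
  let a := vecDet q r s
  let b := - vecDet p r s
  let c := - vecDet p q s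
  let d := vecDet p q r
  (0 < a || 0 < b || 0 < c || 0 < d) && (a < 0 || b < 0 || c < 0 || d < 0)

/-- A linear relation between integer vectors, written in coordinates. -/
def Relation (a b c d : ℝ) (p q r s : ℤ × ℤ × ℤ) : Prop :=
  a * p.1 + b * q.1 = c * r.1 + d * s.1 ∧ a * p.2.1 + b * q.2.1 = c * r.2.1 + d * s.2.1 ∧
    a * p.2.2 + b * q.2.2 = c * r.2.2 + d * s.2.2

lemma eq_zero_of_proportional {x y z w α β γ δ : ℝ} (hx : 0 ≤ x) (hy : 0 ≤ y)
    (hxy : x * β = y * α) (hxz : x * γ = z * α) (hxw : x * δ = w * α) (hα : 0 < α) (hβ : β < 0) :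
    x = 0 ∧ y = 0 ∧ z = 0 ∧ w = 0 := by
  have h1 : x = 0 := by nlinarith [mul_nonneg hy hα.le, mul_nonneg hx (neg_nonneg.2 hβ.le)]
  subst h1
  simp only [zero_mul, zero_eq_mul, hα.ne', or_false] at hxy hxz hxw
  exact ⟨rfl, hxy, hxz, hxw⟩

lemma Relation.eq_zero {a b c d : ℝ} {p q r s : ℤ × ℤ × ℤ} (h : Relation a b c d p q r s)
    (ha : 0 ≤ a) (hb : 0 ≤ b) (hc : 0 ≤ c) (hd : 0 ≤ d) (hm : conesMeetTrivially p q r s = true) :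
    a = 0 ∧ b = 0 ∧ c = 0 ∧ d = 0 := by
  obtain ⟨h1, h2, h3⟩ := h
  simp only [conesMeetTrivially, Bool.and_eq_true, Bool.or_eq_true, decide_eq_true_eq] at hm
  obtain ⟨p1, p2, p3⟩ := p
  obtain ⟨q1, q2, q3⟩ := q
  obtain ⟨r1, r2, r3⟩ := r
  obtain ⟨s1, s2, s3⟩ := s
  simp only at h1 h2 h3
  obtain ⟨α, hα⟩ : ∃ α, α = vecDet (q1, q2, q3) (r1, r2, r3) (s1, s2, s3) := ⟨_, rfl⟩
  obtain ⟨β, hβ⟩ : ∃ β, β = - vecDet (p1, p2, p3) (r1, r2, r3) (s1, s2, s3) := ⟨_, rfl⟩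
  obtain ⟨γ, hγ⟩ : ∃ γ, γ = - vecDet (p1, p2, p3) (q1, q2, q3) (s1, s2, s3) := ⟨_, rfl⟩
  obtain ⟨δ, hδ⟩ : ∃ δ, δ = vecDet (p1, p2, p3) (q1, q2, q3) (r1, r2, r3) := ⟨_, rfl⟩
  rw [← hα, ← hβ, ← hγ, ← hδ] at hm
  simp only [vecDet] at hα hβ hγ hδ
  have hα' : (α : ℝ) = _ := congrArg Int.cast hα
  have hβ' : (β : ℝ) = _ := congrArg Int.cast hβ
  have hγ' : (γ : ℝ) = _ := congrArg Int.cast hγ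
  have hδ' : (δ : ℝ) = _ := congrArg Int.cast hδ
  push_cast at hα' hβ' hγ' hδ'
  have ab : a * β = b * α := by
    rw [hα', hβ']
    linear_combination -(r2 * s3 - r3 * s2 : ℝ) * h1 + (r1 * s3 - r3 * s1 : ℝ) * h2 -
      (r1 * s2 - r2 * s1 : ℝ) * h3
  have ac : a * γ = c * α := by
    rw [hα', hγ']
    linear_combination -(q2 * s3 - q3 * s2 : ℝ) * h1 + (q1 * s3 - q3 * s1 : ℝ) * h2 -
      (q1 * s2 - q2 * s1 : ℝ) * h3
  have ad : a * δ = d * α := by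
    rw [hα', hδ']
    linear_combination (q2 * r3 - q3 * r2 : ℝ) * h1 - (q1 * r3 - q3 * r1 : ℝ) * h2 +
      (q1 * r2 - q2 * r1 : ℝ) * h3
  have bc : b * γ = c * β := by
    rw [hβ', hγ']
    linear_combination (p2 * s3 - p3 * s2 : ℝ) * h1 - (p1 * s3 - p3 * s1 : ℝ) * h2 +
      (p1 * s2 - p2 * s1 : ℝ) * h3
  have bd : b * δ = d * β := by
    rw [hβ', hδ']
    linear_combination -(p2 * r3 - p3 * r2 : ℝ) * h1 + (p1 * r3 - p3 * r1 : ℝ) * h2 -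
      (p1 * r2 - p2 * r1 : ℝ) * h3
  have cd : c * δ = d * γ := by
    rw [hγ', hδ']
    linear_combination -(p2 * q3 - p3 * q2 : ℝ) * h1 + (p1 * q3 - p3 * q1 : ℝ) * h2 -
      (p1 * q2 - p2 * q1 : ℝ) * h3
  have cast_pos : ∀ {n : ℤ}, 0 < n → (0 : ℝ) < n := Int.cast_pos.2
  have cast_neg : ∀ {n : ℤ}, n < 0 → (n : ℝ) < 0 := Int.cast_lt_zero.2
  rcases hm with ⟨((h | h) | h) | h, ((k | k) | k) | k⟩
  · omega
  · have := eq_zero_of_proportional ha hb ab ac ad (cast_pos h) (cast_neg k)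
    tauto
  · have := eq_zero_of_proportional ha hc ac ab ad (cast_pos h) (cast_neg k)
    tauto
  · have := eq_zero_of_proportional ha hd ad ab ac (cast_pos h) (cast_neg k)
    tauto
  · have := eq_zero_of_proportional hb ha ab.symm bc bd (cast_pos h) (cast_neg k)
    tauto
  · omega
  · have := eq_zero_of_proportional hb hc bc ab.symm bd (cast_pos h) (cast_neg k)
    tauto
  · have := eq_zero_of_proportional hb hd bd ab.symm bc (cast_pos h) (cast_neg k)
    tauto
  · have := eq_zero_of_proportional hc ha ac.symm bc.symm cd (cast_pos h) (cast_neg k)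
    tauto
  · have := eq_zero_of_proportional hc hb bc.symm ac.symm cd (cast_pos h) (cast_neg k)
    tauto
  · omega
  · have := eq_zero_of_proportional hc hd cd ac.symm bc.symm (cast_pos h) (cast_neg k)
    tauto
  · have := eq_zero_of_proportional hd ha ad.symm bd.symm cd.symm (cast_pos h) (cast_neg k)
    tauto
  · have := eq_zero_of_proportional hd hb bd.symm ad.symm cd.symm (cast_pos h) (cast_neg k)
    tauto
  · have := eq_zero_of_proportional hd hc cd.symm ad.symm bd.symm (cast_pos h) (cast_neg k)
    tauto
  · omega

lemma Relation.eq_of_vecDet_ne_zero {a b c d : ℝ} {p q s : ℤ × ℤ × ℤ}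
    (h : Relation a b c d p q p s) (hdet : vecDet p q s ≠ 0) : a = c ∧ b = 0 ∧ d = 0 := by
  obtain ⟨h1, h2, h3⟩ := h
  obtain ⟨p1, p2, p3⟩ := p
  obtain ⟨q1, q2, q3⟩ := q
  obtain ⟨s1, s2, s3⟩ := s
  simp only at h1 h2 h3
  have hD : ((vecDet (p1, p2, p3) (q1, q2, q3) (s1, s2, s3) : ℤ) : ℝ) ≠ 0 := by exact_mod_cast hdet
  simp only [vecDet] at hD
  push_cast at hD
  refine ⟨sub_eq_zero.1 ((mul_eq_zero.1 (?_ : (a - c) * _ = 0)).resolve_right hD),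
    (mul_eq_zero.1 (?_ : b * _ = 0)).resolve_right hD,
    (mul_eq_zero.1 (?_ : d * _ = 0)).resolve_right hD⟩
  · linear_combination (q2 * s3 - q3 * s2 : ℝ) * h1 - (q1 * s3 - q3 * s1 : ℝ) * h2 +
      (q1 * s2 - q2 * s1 : ℝ) * h3
  · linear_combination -(p2 * s3 - p3 * s2 : ℝ) * h1 + (p1 * s3 - p3 * s1 : ℝ) * h2 -
      (p1 * s2 - p2 * s1 : ℝ) * h3
  · linear_combination -(p2 * q3 - p3 * q2 : ℝ) * h1 + (p1 * q3 - p3 * q1 : ℝ) * h2 -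
      (p1 * q2 - p2 * q1 : ℝ) * h3

lemma Relation.eq_of_vecIndep {a b c d : ℝ} {p q : ℤ × ℤ × ℤ} (h : Relation a b c d p q p q)
    (hpq : vecIndep p q = true) : a = c ∧ b = d := by
  obtain ⟨h1, h2, h3⟩ := h
  obtain ⟨p1, p2, p3⟩ := p
  obtain ⟨q1, q2, q3⟩ := q
  simp only at h1 h2 h3
  simp only [vecIndep, Bool.or_eq_true, bne_iff_ne, ne_eq] at hpq
  have key : ∀ m : ℤ, m ≠ 0 → (a - c) * m = 0 → (b - d) * m = 0 → a = c ∧ b = d := by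
    intro m hm e1 e2
    have hm' : (m : ℝ) ≠ 0 := by exact_mod_cast hm
    exact ⟨sub_eq_zero.1 ((mul_eq_zero.1 e1).resolve_right hm'),
      sub_eq_zero.1 ((mul_eq_zero.1 e2).resolve_right hm')⟩
  rcases hpq with (h | h) | h <;> refine key _ h ?_ ?_ <;> push_cast
  · linear_combination (q2 : ℝ) * h1 - (q1 : ℝ) * h2
  · linear_combination (p1 : ℝ) * h2 - (p2 : ℝ) * h1
  · linear_combination (q3 : ℝ) * h1 - (q1 : ℝ) * h3
  · linear_combination (p1 : ℝ) * h3 - (p3 : ℝ) * h1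
  · linear_combination (q3 : ℝ) * h2 - (q2 : ℝ) * h3
  · linear_combination (p2 : ℝ) * h3 - (p3 : ℝ) * h2

/-- An integer vector as a point of Euclidean space. -/
noncomputable def toPoint (p : ℤ × ℤ × ℤ) : E3 := !₂[(p.1 : ℝ), (p.2.1 : ℝ), (p.2.2 : ℝ)]

/-- The two triangles `vpq` and `vrs` at the vertex `v` span cones that meet only in the cone over
their common face. -/
def conesCompatible {n : ℕ} (ψ : Fin n → ℤ × ℤ × ℤ) (v p q r s : Fin n) : Bool :=
  if p = r then q = s || vecDet (vecSub (ψ p) (ψ v)) (vecSub (ψ q) (ψ v)) (vecSub (ψ s) (ψ v)) != 0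
  else if p = s then
    q = r || vecDet (vecSub (ψ p) (ψ v)) (vecSub (ψ q) (ψ v)) (vecSub (ψ r) (ψ v)) != 0
  else if q = r then vecDet (vecSub (ψ q) (ψ v)) (vecSub (ψ p) (ψ v)) (vecSub (ψ s) (ψ v)) != 0
  else if q = s then vecDet (vecSub (ψ q) (ψ v)) (vecSub (ψ p) (ψ v)) (vecSub (ψ r) (ψ v)) != 0
  else conesMeetTrivially (vecSub (ψ p) (ψ v)) (vecSub (ψ q) (ψ v)) (vecSub (ψ r) (ψ v))
    (vecSub (ψ s) (ψ v))

section Star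

variable {n : ℕ}

lemma sum_mul_of_support {v p q : Fin n} (hvp : v ≠ p) (hvq : v ≠ q) (hpq : p ≠ q) {x : Fin n → ℝ}
    (h1 : ∑ w, x w = 1) (hx : ∀ w, x w ≠ 0 → w = v ∨ w = p ∨ w = q) (g : Fin n → ℝ) :
    ∑ w, x w * g w = g v + x p * (g p - g v) + x q * (g q - g v) := by
  have key : ∀ g : Fin n → ℝ, ∑ w, x w * g w = x v * g v + (x p * g p + x q * g q) := fun g => by
    rw [← sum_subset (subset_univ {v, p, q}), sum_insert (by simp [hvp, hvq]),
      sum_insert (by simpa using hpq), sum_singleton]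
    intro w _ hw
    have hw0 : x w = 0 := by
      by_contra hne
      exact hw (by simpa using hx w hne)
    rw [hw0, zero_mul]
  have h2 := key fun _ => 1
  simp only [mul_one, h1] at h2
  rw [key]
  linear_combination -g v * h2

lemma eq_of_eq_off_vertex {v : Fin n} {x y : Fin n → ℝ} (hx : ∑ w, x w = 1) (hy : ∑ w, y w = 1)
    (h : ∀ w, w ≠ v → x w = y w) : x = y := by
  funext w
  by_cases hw : w = v
  · subst hw
    have h1 := add_sum_erase univ x (mem_univ w)
    have h2 := add_sum_erase univ y (mem_univ w)
    rw [sum_congr rfl fun u hu => h u (ne_of_mem_erase hu)] at h1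
    linarith
  · exact h w hw

/-- Points of two compatible triangles at a vertex with the same image are equal. -/
lemma eq_of_conesCompatible {ψ : Fin n → ℤ × ℤ × ℤ} {v p q r s : Fin n}
    (hvp : v ≠ p) (hvq : v ≠ q) (hpq : p ≠ q) (hvr : v ≠ r) (hvs : v ≠ s) (hrs : r ≠ s)
    (hind : vecIndep (vecSub (ψ p) (ψ v)) (vecSub (ψ q) (ψ v)) = true)
    (hcomp : conesCompatible ψ v p q r s = true) {x y : Fin n → ℝ}
    (hx0 : ∀ w, 0 ≤ x w) (hy0 : ∀ w, 0 ≤ y w) (hx1 : ∑ w, x w = 1) (hy1 : ∑ w, y w = 1)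
    (hx : ∀ w, x w ≠ 0 → w = v ∨ w = p ∨ w = q) (hy : ∀ w, y w ≠ 0 → w = v ∨ w = r ∨ w = s)
    (h1 : ∑ w, x w * ((ψ w).1 : ℝ) = ∑ w, y w * ((ψ w).1 : ℝ))
    (h2 : ∑ w, x w * ((ψ w).2.1 : ℝ) = ∑ w, y w * ((ψ w).2.1 : ℝ))
    (h3 : ∑ w, x w * ((ψ w).2.2 : ℝ) = ∑ w, y w * ((ψ w).2.2 : ℝ)) : x = y := by
  have hsum : ∀ g : Fin n → ℝ, ∑ w, x w * g w = ∑ w, y w * g w →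
      x p * (g p - g v) + x q * (g q - g v) = y r * (g r - g v) + y s * (g s - g v) := by
    intro g h
    rw [sum_mul_of_support hvp hvq hpq hx1 hx, sum_mul_of_support hvr hvs hrs hy1 hy] at h
    linarith
  have hrel : Relation (x p) (x q) (y r) (y s) (vecSub (ψ p) (ψ v)) (vecSub (ψ q) (ψ v))
      (vecSub (ψ r) (ψ v)) (vecSub (ψ s) (ψ v)) := by
    refine ⟨?_, ?_, ?_⟩ <;> simp only [vecSub] <;> push_cast
    exacts [hsum _ h1, hsum _ h2, hsum _ h3]
  have hswap : ∀ {a b c d : ℝ} {P Q R S : ℤ × ℤ × ℤ}, Relation a b c d P Q R S →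
      Relation b a c d Q P R S ∧ Relation a b d c P Q S R := fun h =>
    ⟨⟨by linarith [h.1], by linarith [h.2.1], by linarith [h.2.2]⟩,
      ⟨by linarith [h.1], by linarith [h.2.1], by linarith [h.2.2]⟩⟩
  have hzx : ∀ w, w ≠ v → w ≠ p → w ≠ q → x w = 0 := fun w h1 h2 h3 => by
    by_contra hne
    rcases hx w hne with h | h | h <;> contradiction
  have hzy : ∀ w, w ≠ v → w ≠ r → w ≠ s → y w = 0 := fun w h1 h2 h3 => by
    by_contra hne
    rcases hy w hne with h | h | h <;> contradiction
  refine eq_of_eq_off_vertex (v := v) hx1 hy1 ?_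
  have hxp := hx0 p
  have hxq := hx0 q
  have hyr := hy0 r
  have hys := hy0 s
  clear hsum h1 h2 h3 hx1 hy1 hx hy hx0 hy0
  unfold conesCompatible at hcomp
  split_ifs at hcomp with c1 c2 c3 c4
  · subst c1
    simp only [Bool.or_eq_true, decide_eq_true_eq, bne_iff_ne, ne_eq] at hcomp
    by_cases hqs : q = s
    · subst hqs
      obtain ⟨e1, e2⟩ := hrel.eq_of_vecIndep hind
      clear hrel hswap hcomp hind
      grind
    · obtain ⟨e1, e2, e3⟩ := hrel.eq_of_vecDet_ne_zero (hcomp.resolve_left hqs)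
      clear hrel hswap hcomp hind
      grind
  · subst c2
    simp only [Bool.or_eq_true, decide_eq_true_eq, bne_iff_ne, ne_eq] at hcomp
    by_cases hqr : q = r
    · subst hqr
      obtain ⟨e1, e2⟩ := (hswap hrel).2.eq_of_vecIndep hind
      clear hrel hswap hcomp hind
      grind
    · obtain ⟨e1, e2, e3⟩ := (hswap hrel).2.eq_of_vecDet_ne_zero (hcomp.resolve_left hqr)
      clear hrel hswap hcomp hind
      grind
  · subst c3
    rw [bne_iff_ne] at hcomp
    obtain ⟨e1, e2, e3⟩ := (hswap hrel).1.eq_of_vecDet_ne_zero hcomp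
    clear hrel hswap hcomp hind
    grind
  · subst c4
    rw [bne_iff_ne] at hcomp
    obtain ⟨e1, e2, e3⟩ := (hswap (hswap hrel).1).2.eq_of_vecDet_ne_zero hcomp
    clear hrel hswap hcomp hind
    grind
  · obtain ⟨e1, e2, e3, e4⟩ := hrel.eq_zero hxp hxq hyr hys hcomp
    clear hrel hswap hcomp hind
    grind

end Star

/-- The edges opposite to a vertex in the triangles that contain it. -/
def linkEdges {n : ℕ} (T : List (Fin n × Fin n × Fin n)) (v : Fin n) : List (Fin n × Fin n) :=
  T.flatMap fun t => if t.1 = v then [(t.2.1, t.2.2)] else if t.2.1 = v then [(t.1, t.2.2)]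
    else if t.2.2 = v then [(t.1, t.2.1)] else []

/-- The triangles at each vertex are nondegenerate and pairwise compatible. -/
def starsEmbedded {n : ℕ} (T : List (Fin n × Fin n × Fin n)) (ψ : Fin n → ℤ × ℤ × ℤ) : Bool :=
  (List.finRange n).all fun v => (linkEdges T v).all fun e =>
    v != e.1 && v != e.2 && e.1 != e.2 &&
    vecIndep (vecSub (ψ e.1) (ψ v)) (vecSub (ψ e.2) (ψ v)) &&
    (linkEdges T v).all fun e' => conesCompatible ψ v e.1 e.2 e'.1 e'.2

lemma exists_mem_linkEdges {n : ℕ} {T : List (Fin n × Fin n × Fin n)} {t : Fin n × Fin n × Fin n}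
    (ht : t ∈ T) {v : Fin n} (hv : v ∈ bits n (triangleMask t.1 t.2.1 t.2.2)) :
    ∃ e ∈ linkEdges T v, ∀ w ∈ bits n (triangleMask t.1 t.2.1 t.2.2),
      w = v ∨ w = e.1 ∨ w = e.2 := by
  rw [bits_triangleMask] at hv ⊢
  simp only [mem_insert, mem_singleton] at hv ⊢
  have hmem : ∀ e, e ∈ (if t.1 = v then [(t.2.1, t.2.2)] else if t.2.1 = v then [(t.1, t.2.2)]
    else if t.2.2 = v then [(t.1, t.2.1)] else []) → e ∈ linkEdges T v :=
    fun e he => List.mem_flatMap.2 ⟨t, ht, he⟩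
  by_cases h1 : t.1 = v
  · exact ⟨_, hmem (t.2.1, t.2.2) (by simp [h1]), by grind⟩
  · by_cases h2 : t.2.1 = v
    · exact ⟨_, hmem (t.1, t.2.2) (by simp [h1, h2]), by grind⟩
    · have h3 : t.2.2 = v := by grind
      exact ⟨_, hmem (t.1, t.2.1) (by simp [h1, h2, h3]), by grind⟩

/-- A simplexwise linear map that is injective on vertex stars is an immersion. -/
theorem isImmersion_of_starsEmbedded {n : ℕ} {T : List (Fin n × Fin n × Fin n)}
    {ψ : Fin n → ℤ × ℤ × ℤ} (h : starsEmbedded T ψ = true) {F : Set (Finset (Fin n))}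
    (hF : F = facets n (T.map fun t => triangleMask t.1 t.2.1 t.2.2)) (hc : ∀ v, ∃ t ∈ F, v ∈ t) :
    IsImmersion (ofFacets F hc) fun v => toPoint (ψ v) := by
  intro x
  have hx : x.1 ∈ carrier F := (space_ofFacets F hc).le x.2
  obtain ⟨v, -, hv⟩ := exists_ne_zero_of_sum_ne_zero (hx.2.1.trans_ne one_ne_zero)
  refine ⟨{y | y.1 v ≠ 0}, ?_, hv, ?_⟩
  · exact isOpen_ne_fun ((continuous_apply v).comp continuous_subtype_val) continuous_const
  · intro y hyv z hzv hyz
    obtain ⟨hy0, hy1, _, hyF, hys⟩ : y.1 ∈ carrier F := (space_ofFacets F hc).le y.2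
    obtain ⟨hz0, hz1, _, hzF, hzs⟩ : z.1 ∈ carrier F := (space_ofFacets F hc).le z.2
    rw [hF] at hyF hzF
    obtain ⟨m, hm, rfl⟩ := hyF
    obtain ⟨m', hm', rfl⟩ := hzF
    obtain ⟨t, ht, rfl⟩ := List.mem_map.1 hm
    obtain ⟨t', ht', rfl⟩ := List.mem_map.1 hm'
    obtain ⟨e, he, het⟩ := exists_mem_linkEdges ht (hys v hyv)
    obtain ⟨e', he', het'⟩ := exists_mem_linkEdges ht' (hzs v hzv)
    simp only [starsEmbedded, List.all_eq_true, Bool.and_eq_true, bne_iff_ne] at h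
    obtain ⟨⟨⟨⟨a1, a2⟩, a3⟩, a4⟩, a5⟩ := h v (List.mem_finRange v) e he
    obtain ⟨⟨⟨⟨b1, b2⟩, b3⟩, -⟩, -⟩ := h v (List.mem_finRange v) e' he'
    refine Subtype.ext (eq_of_conesCompatible a1 a2 a3 b1 b2 b3 a4 (a5 e' he') hy0 hz0 hy1 hz1
      (fun w hw => het w (hys w hw)) (fun w hw => het' w (hzs w hw)) ?_ ?_ ?_)
    all_goals
      have hcoord : ∀ k, ∑ w, y.1 w * toPoint (ψ w) k = ∑ w, z.1 w * toPoint (ψ w) k := fun k => by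
        have := congrArg (fun u : E3 => u k) hyz
        simpa [simplexwiseLinear] using this
    exacts [hcoord 0, hcoord 1, hcoord 2]

/-- The cyclic permutation of the coordinates of an integer vector. -/
def cycle (p : ℤ × ℤ × ℤ) : ℤ × ℤ × ℤ := (p.2.2, p.1, p.2.1)

lemma cyclicIsometry_toPoint (p : ℤ × ℤ × ℤ) : cyclicIsometry (toPoint p) = toPoint (cycle p) := by
  ext k
  rw [cyclicIsometry_apply]
  fin_cases k
  · rfl
  · rfl
  · rfl

/-- The coordinates of the vertices. -/
def SymmetricSurface.coordinates (S : SymmetricSurface) : Fin 10 → ℤ × ℤ × ℤ :=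
  ![(S.apex, S.apex, S.apex), S.base 0, cycle (S.base 0), cycle (cycle (S.base 0)),
    S.base 1, cycle (S.base 1), cycle (cycle (S.base 1)),
    S.base 2, cycle (S.base 2), cycle (cycle (S.base 2))]

lemma SymmetricSurface.cycle_coordinates (S : SymmetricSurface) (v : Fin 10) :
    cycle (S.coordinates v) = S.coordinates (rotation v) := by
  fin_cases v <;> rfl

set_option maxHeartbeats 4000000 in
lemma starsEmbedded_surfaces :
    ∀ i, starsEmbedded (surfaces i).triangles (surfaces i).coordinates = true := by
  decide +kernel

lemma rotation_cubed : ∀ v, rotation (rotation (rotation v)) = v := by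
  decide

/-- The rotation as a permutation of the vertices. -/
def rotationEquiv : Fin 10 ≃ Fin 10 where
  toFun := rotation
  invFun v := rotation (rotation v)
  left_inv := rotation_cubed
  right_inv := rotation_cubed

lemma rotation_mem_masks : ∀ i, ((surfaces i).triangles.all fun t => (surfaces i).masks.contains
    (triangleMask (rotation t.1) (rotation t.2.1) (rotation t.2.2))) = true := by
  decide +kernel

lemma map_rotation_mem (i : Fin 10) : ∀ t ∈ facets 10 (surfaces i).masks,
    t.map rotationEquiv.toEmbedding ∈ facets 10 (surfaces i).masks := by
  rintro _ ⟨m, hm, rfl⟩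
  obtain ⟨t, ht, rfl⟩ := List.mem_map.1 hm
  have h := List.all_eq_true.1 (rotation_mem_masks i) t ht
  refine ⟨_, List.contains_iff_mem.1 h, ?_⟩
  rw [bits_triangleMask, bits_triangleMask]
  simp [rotationEquiv]

lemma exists_mem_masks : ∀ i, ∀ v : Fin 10, ∃ m ∈ (surfaces i).masks, m.testBit v = true := by
  decide +kernel

lemma exists_mem_facets (i : Fin 10) (v : Fin 10) :
    ∃ t ∈ facets 10 (surfaces i).masks, v ∈ t := by
  obtain ⟨m, hm, hv⟩ := exists_mem_masks i v
  exact ⟨_, ⟨m, hm, rfl⟩, mem_bits.2 hv⟩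

/-- The ten triangulations. -/
def surfaceComplex (i : Fin 10) : AbstractSimplicialComplex (Fin 10) :=
  ofFacets (facets 10 (surfaces i).masks) (exists_mem_facets i)

lemma card_bits_masks : ∀ i, ∀ m ∈ (surfaces i).masks, #(bits 10 m) = 3 := by
  decide +kernel

theorem isTriangulationOf_surfaceComplex (i : Fin 10) :
    IsTriangulationOf (surfaceComplex i) (NonorientableSurface 5) := by
  refine ⟨?_, ?_, ?_⟩
  · rintro s ⟨-, _, ⟨m, hm, rfl⟩, hs⟩
    exact (card_le_card hs).trans (card_bits_masks i m hm).le
  · have hm : triangleMask (1 : Fin 10) (2 : Fin 10) (3 : Fin 10) ∈ (surfaces i).masks :=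
      List.mem_map.2 ⟨_, List.mem_cons_self, rfl⟩
    have hcard := card_bits_masks i _ hm
    exact ⟨_, ⟨card_pos.1 (by omega), _, ⟨_, hm, rfl⟩, Subset.rfl⟩, hcard⟩
  · rw [surfaceComplex, space_ofFacets]
    exact nonempty_homeomorph_surface i

/-! ### A combinatorial invariant -/

section Invariant

variable {V : Type*} [DecidableEq V]

/-- The sum, over the pairs of adjacent triangles whose common edge can be flipped, of the products
of the degrees of the four vertices. -/
def flipInvariant (T : Finset (Finset V)) : ℕ :=
  ∑ t ∈ T, ∑ u ∈ T, if #(t ∩ u) = 2 ∧ ∀ r ∈ T, ¬ symmDiff t u ⊆ r then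
    ∏ w ∈ t ∪ u, #{r ∈ T | w ∈ r} else 0

lemma flipInvariant_map (σ : V ≃ V) (T : Finset (Finset V)) :
    flipInvariant (T.map (mapEmbedding σ.toEmbedding).toEmbedding) = flipInvariant T := by
  have hdeg : ∀ w, #{r ∈ T.map (mapEmbedding σ.toEmbedding).toEmbedding | σ w ∈ r} =
      #{r ∈ T | w ∈ r} := fun w => by
    rw [filter_map, card_map]
    simp [Function.comp_def]
  have hsd : ∀ t u r : Finset V, symmDiff (t.map σ.toEmbedding) (u.map σ.toEmbedding) ⊆
      r.map σ.toEmbedding ↔ symmDiff t u ⊆ r := fun t u r => by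
    rw [map_eq_image, map_eq_image, ← image_symmDiff _ _ σ.toEmbedding.injective, ← map_eq_image,
      map_subset_map]
  unfold flipInvariant
  rw [sum_map]
  refine sum_congr rfl fun t _ => ?_
  rw [sum_map]
  refine sum_congr rfl fun u _ => ?_
  simp only [RelEmbedding.coe_toEmbedding, mapEmbedding_apply, ← map_inter, ← map_union, card_map,
    forall_mem_map, hsd, prod_map, Equiv.coe_toEmbedding, hdeg]

/-- The invariant in terms of a list of triangles. -/
def flipInvariantList (L : List (Finset V)) : ℕ :=
  (L.map fun t => (L.map fun u => if #(t ∩ u) = 2 ∧ ∀ r ∈ L, ¬ symmDiff t u ⊆ r then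
    ∏ w ∈ t ∪ u, L.countP (fun r => w ∈ r) else 0).sum).sum

lemma flipInvariant_toFinset {L : List (Finset V)} (hL : L.Nodup) :
    flipInvariant L.toFinset = flipInvariantList L := by
  have hdeg : ∀ w, #{r ∈ L.toFinset | w ∈ r} = L.countP (fun r => w ∈ r) := fun w => by
    rw [List.countP_eq_length_filter, ← List.toFinset_card_of_nodup (hL.filter _),
      List.toFinset_filter]
    simp
  simp only [flipInvariant, flipInvariantList, List.sum_toFinset _ hL, hdeg, List.mem_toFinset]

end Invariant

set_option maxHeartbeats 4000000 in
lemma nodup_map_bits : ∀ i, ((surfaces i).masks.map (bits 10)).Nodup := by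
  decide +kernel

/-- The values of the invariant on the ten triangulations. -/
def flipInvariantValue : Fin 10 → ℕ :=
  ![59136, 36288, 78288, 38880, 64800, 39648, 61824, 86016, 47628, 36864]

set_option maxHeartbeats 4000000 in
lemma flipInvariantList_surfaces :
    ∀ i, flipInvariantList ((surfaces i).masks.map (bits 10)) = flipInvariantValue i := by
  decide +kernel

lemma flipInvariantValue_injective : Function.Injective flipInvariantValue := by
  decide

lemma mem_toFinset_iff_mem_faces {i : Fin 10} {s : Finset (Fin 10)} :
    s ∈ ((surfaces i).masks.map (bits 10)).toFinset ↔ s ∈ (surfaceComplex i).faces ∧ #s = 3 := by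
  rw [List.mem_toFinset, List.mem_map, surfaceComplex, mem_faces_ofFacets]
  constructor
  · rintro ⟨m, hm, rfl⟩
    have hcard := card_bits_masks i m hm
    exact ⟨⟨card_pos.1 (by omega), _, ⟨m, hm, rfl⟩, Subset.rfl⟩, hcard⟩
  · rintro ⟨⟨-, _, ⟨m, hm, rfl⟩, hs⟩, hcard⟩
    exact ⟨m, hm, (eq_of_subset_of_card_le hs (by rw [hcard, card_bits_masks i m hm])).symm⟩

theorem not_isIso_surfaceComplex {i j : Fin 10} (hij : i ≠ j) (σ : Fin 10 ≃ Fin 10) :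
    ¬ IsIso (surfaceComplex i) (surfaceComplex j) σ := by
  intro h
  have hT : ((surfaces j).masks.map (bits 10)).toFinset =
      ((surfaces i).masks.map (bits 10)).toFinset.map (mapEmbedding σ.toEmbedding).toEmbedding := by
    ext s
    have hs : (s.map σ.symm.toEmbedding).map σ.toEmbedding = s := by
      ext v
      simp
    rw [mem_map]
    constructor
    · intro hsj
      refine ⟨s.map σ.symm.toEmbedding, ?_, hs⟩
      rw [mem_toFinset_iff_mem_faces] at hsj ⊢
      rwa [h, hs, card_map]
    · rintro ⟨t, ht, rfl⟩
      rw [mem_toFinset_iff_mem_faces] at ht ⊢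
      exact ⟨(h t).1 ht.1, (card_map _).trans ht.2⟩
  have hval := congrArg flipInvariant hT
  rw [flipInvariant_map, flipInvariant_toFinset (nodup_map_bits i),
    flipInvariant_toFinset (nodup_map_bits j), flipInvariantList_surfaces,
    flipInvariantList_surfaces] at hval
  exact hij (flipInvariantValue_injective hval.symm)

end PolyhedralSurface

open PolyhedralSurface in
theorem theorem6 :
    ∃ Δ : Fin 10 → AbstractSimplicialComplex (Fin 10),
      (∀ i, IsTriangulationOf (Δ i) (NonorientableSurface 5)) ∧
      (∀ i j, i ≠ j → ¬ ∃ σ : Fin 10 ≃ Fin 10, IsIso (Δ i) (Δ j) σ) ∧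
      ∀ i, ∃ ψ : Fin 10 → E3,
        (∀ v k, ∃ m : ℤ, ψ v k = m) ∧
        IsImmersion (Δ i) ψ ∧
        ∃ R : E3 ≃ᵃⁱ[ℝ] E3, IsThreefoldRotation R ∧ IsGeometricSymmetry (Δ i) ψ R := by
  refine ⟨surfaceComplex, isTriangulationOf_surfaceComplex,
    fun i j hij ⟨σ, hσ⟩ => not_isIso_surfaceComplex hij σ hσ, fun i =>
    ⟨fun v => toPoint ((surfaces i).coordinates v), fun v k => ?_,
      isImmersion_of_starsEmbedded (starsEmbedded_surfaces i) rfl (exists_mem_facets i),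
      cyclicIsometry.toAffineIsometryEquiv, isThreefoldRotation_cyclicIsometry,
      isGeometricSymmetry_of_linear (σ := rotationEquiv)
        (isIso_ofFacets rotation_cubed (map_rotation_mem i)) fun v => ?_⟩⟩
  · fin_cases k
    exacts [⟨_, rfl⟩, ⟨_, rfl⟩, ⟨_, rfl⟩]
  · rw [cyclicIsometry_toPoint, SymmetricSurface.cycle_coordinates]
    rfl
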